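/- Let $\hbar>0$. Consider a Hamiltonian $H=\sum_j E_j|E_j\rangle\langle E_j|$, diagonal in an orthonormal basis of a complex Hilbert space of arbitrary dimension, a unit vector $|\psi\rangle=\sum_j a_j|E_j\rangle$, its evolution $|\psi(t)\rangle=e^{-iHt/\hbar}|\psi\rangle$, the fidelity $F(t)=|\langle\psi|\psi(t)\rangle|^2$, and the moments $\langle|E|^r\rangle=\sum_j|a_j|^2|E_j|^r$. Let $H_e$ be the five-level Hamiltonian with energies $0,\pm\hbar,\pm11\hbar/5$, and let $$|\varphi_e\rangle=\tfrac1{\sqrt{15}}\left[\sqrt7\,|0\rangle+\sqrt2\left(|\hbar\rangle+|-\hbar\rangle+|11\hbar/5\rangle+|-11\hbar/5\rangle\right)\right].$$ Let $\tau_{c1}\approx9.693$ be the first time at which the root fidelity $|\langle\varphi_e|\varphi_e(t)\rangle|$ vanishes, and let $\tau_{c2}\approx4.110$ (i.e. $|\tau_{c2}-4.110|\le0.0005$) be the time at which it has its local minimum ($\approx0.0682$). Let $p_e(x)=\sum_k c_kx^k$ be the Hermite interpolating polynomial of degree at most $34$ such that $p_e^{(j)}(x)=\cos^{(j)}(x)$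 for $0\le j\le2$ at $x=0$, for $0\le j\le3$ at $x=\pm\tau_{c1}$, for $0\le j\le1$ at $x=\pm\tau_{c2}$, for $0\le j\le5$ at $x=\pm11\tau_{c1}/5$, and for $0\le j\le3$ at $x=\pm11\tau_{c2}/5$. It induces the quantum speed limit $\sqrt F\ge\sum_{k=0}^{17}c_{2k}\langle|E|^{2k}\rangle(\tau/\hbar)^{2k}$. Call $(H,|\psi\rangle,\tau)$ with $\tau\ge0$ a magic state if $\langle|E|^{2k}\rangle=4\hbar^{2k}[1+(11/5)^{2k}]/15$ for $k=1,\dots,17$, the fidelity at time $\tau$ is $F=0$, and the above inequality is an equality: $0=\sum_{k=0}^{17}c_{2k}\langle|E|^{2k}\rangle(\tau/\hbar)^{2k}$. Then such data $\tau_{c1},\tau_{c2},p_e$ exist, $(H_e,|\varphi_e\rangle,\tau_{c1})$ is a magic state, and every magic state $(H,|\psi\rangle,\tau)$ has the following properties. There is $E>0$ (in fact $E=\hbar$ in the units used) with $$|\psi\rangle=\alpha_0|0\rangle+\alpha_1|E\rangle+\alpha_2|-E\rangle+\alpha_3|11E/5\rangle+\alpha_4|-11E/5\rangle,$$ where $|e\rangle$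 denotes a unit eigenvector of $H$ of energy $e$ (required to exist only if its coefficient is non-zero); the evolution time is $\tau=\tau_{c1}\hbar/E$; $|\alpha_0|^2=7/15$ and $|\alpha_1|^2+|\alpha_2|^2=|\alpha_3|^2+|\alpha_4|^2=4/15$; at most one of the $\alpha_j$ is zero, and $\alpha_3,\alpha_4\ne0$. Hence the state is at least four-dimensional: the orbit $\{|\psi(t)\rangle:t\in\mathbb R\}$ spans a space of dimension at least $4$. The relative phase rotated during the time $\tau$ between the extreme components $|\pm11E/5\rangle$ is $22\tau_{c1}/5>2\pi$. -/

import Mathlib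

open scoped InnerProductSpace

noncomputable section

namespace QSL

/-- A time-independent Hamiltonian in diagonal form `∑ j, E j |E_j⟩⟨E_j|`: the kets `basis j` form
an orthonormal (Hilbert) basis of the complex Hilbert space `𝓗`, whose dimension is arbitrary.
The real numbers `energy j` may repeat and need not be bounded. -/
structure Hamiltonian (ι : Type*) (𝓗 : Type*) [NormedAddCommGroup 𝓗] [InnerProductSpace ℂ 𝓗] where
  basis : HilbertBasis ι ℂ 𝓗
  energy : ι → ℝ

namespace Hamiltonian

variable {ι : Type*} {𝓗 : Type*} [NormedAddCommGroup 𝓗] [InnerProductSpace ℂ 𝓗]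

/-- The amplitude `α_j = ⟨E_j|ψ⟩` in the energy eigenbasis. -/
def amplitude (H : Hamiltonian ι 𝓗) (ψ : 𝓗) (j : ι) : ℂ := ⟪H.basis j, ψ⟫_ℂ

/-- The evolved state `e^{-iHt/ħ} ψ = ∑ j, e^{-i E_j t/ħ} α_j |E_j⟩`. -/
def evolve (H : Hamiltonian ι 𝓗) (ħ : ℝ) (ψ : 𝓗) (t : ℝ) : 𝓗 :=
  ∑' j, (Complex.exp (-Complex.I * ((H.energy j * t / ħ : ℝ) : ℂ)) * H.amplitude ψ j) • H.basis j

/-- The series that defines the evolved state converges. -/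
theorem hasSum_evolve (H : Hamiltonian ι 𝓗) (ħ : ℝ) (ψ : 𝓗) (t : ℝ) :
    HasSum (fun j => (Complex.exp (-Complex.I * ((H.energy j * t / ħ : ℝ) : ℂ)) *
      H.amplitude ψ j) • H.basis j) (H.evolve ħ ψ t) := by
  have hmem : Memℓp (fun j => Complex.exp (-Complex.I * ((H.energy j * t / ħ : ℝ) : ℂ)) *
      H.amplitude ψ j) 2 := by
    have h0 : Memℓp (fun j => H.amplitude ψ j) 2 := by
      have h1 := lp.memℓp (H.basis.repr ψ)
      have h2 : (fun j => H.amplitude ψ j) = ⇑(H.basis.repr ψ) := by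
        funext j
        rw [amplitude, HilbertBasis.repr_apply_apply]
      rw [h2]
      exact h1
    refine Memℓp.mono' h0 fun j => ?_
    have h3 : ‖Complex.exp (-Complex.I * ((H.energy j * t / ħ : ℝ) : ℂ))‖ = 1 := by
      rw [Complex.norm_exp]
      simp
    rw [norm_mul, h3, one_mul]
  exact (H.basis.hasSum_repr_symm ⟨_, hmem⟩).summable.hasSum

/-- The fidelity `|⟨ψ|ψ(t)⟩|²` between a state and the state that evolves from it in time `t`. -/
def fidelity (H : Hamiltonian ι 𝓗) (ħ : ℝ) (ψ : 𝓗) (t : ℝ) : ℝ :=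
  ‖⟪ψ, H.evolve ħ ψ t⟫_ℂ‖ ^ 2

/-- The absolute energy moment `⟨|E|^r⟩ = ∑ j, |α_j|² |E_j|^r`. -/
def absMoment (H : Hamiltonian ι 𝓗) (ψ : 𝓗) (r : ℕ) : ℝ :=
  ∑' j, ‖H.amplitude ψ j‖ ^ 2 * |H.energy j| ^ r

/-- `v` is a ket `|e⟩`: a unit vector with `H v = ∑ j, E_j ⟨E_j|v⟩ |E_j⟩ = e v`. -/
def IsEigenket (H : Hamiltonian ι 𝓗) (e : ℝ) (v : 𝓗) : Prop :=
  ‖v‖ = 1 ∧ HasSum (fun j => ((H.energy j : ℂ) * H.amplitude v j) • H.basis j) ((e : ℂ) • v)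

/-- The dimension of the space explored by the state: the span of its orbit
`{e^{-iHt/ħ} ψ : t ∈ ℝ}`. -/
def orbitDim (H : Hamiltonian ι 𝓗) (ħ : ℝ) (ψ : 𝓗) : ℕ :=
  Module.finrank ℂ (Submodule.span ℂ (Set.range fun t : ℝ => H.evolve ħ ψ t))

/-- The right-hand side `∑ k ≤ 17, c_{2k} ⟨|E|^{2k}⟩ (τ/ħ)^{2k}` of the quantum speed limit
induced by an even polynomial `p(x) = ∑ k ≤ 17, c_{2k} x^{2k}`. -/
def qslBound (H : Hamiltonian ι 𝓗) (ħ : ℝ) (p : Polynomial ℝ) (ψ : 𝓗) (τ : ℝ) : ℝ :=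
  ∑ k ∈ Finset.range 18, p.coeff (2 * k) * H.absMoment ψ (2 * k) * (τ / ħ) ^ (2 * k)

/-- After the evolution time `τ` the fidelity is `F`, and the quantum speed limit
`√F ≥ ∑ k, c_{2k} ⟨|E|^{2k}⟩ (τ/ħ)^{2k}` is an equality. -/
def SaturatesQSL (H : Hamiltonian ι 𝓗) (ħ : ℝ) (p : Polynomial ℝ) (ψ : 𝓗) (τ F : ℝ) : Prop :=
  H.fidelity ħ ψ τ = F ∧ Real.sqrt F = H.qslBound ħ p ψ τ

/-- The moments `⟨|E|^{2k}⟩ = 4 ħ^{2k} [1 + (11/5)^{2k}] / 15` for `k = 1, …, 17`. -/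
def HasGivenMoments (H : Hamiltonian ι 𝓗) (ħ : ℝ) (ψ : 𝓗) : Prop :=
  ∀ k ∈ Finset.Icc 1 17, HasSum (fun j => ‖H.amplitude ψ j‖ ^ 2 * |H.energy j| ^ (2 * k))
    (4 * ħ ^ (2 * k) * (1 + (11 / 5 : ℝ) ^ (2 * k)) / 15)

/-- A magic state, with its evolution time `τ ≥ 0`: a normalized state with the given moments
that saturates the case `F = 0` of the quantum speed limit induced by `p`. -/
structure IsMagicState (H : Hamiltonian ι 𝓗) (ħ : ℝ) (p : Polynomial ℝ) (ψ : 𝓗) (τ : ℝ) :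
    Prop where
  norm_eq_one : ‖ψ‖ = 1
  time_nonneg : 0 ≤ τ
  moments : H.HasGivenMoments ħ ψ
  saturates : H.SaturatesQSL ħ p ψ τ 0

end Hamiltonian

/-- The energy levels `0, E, -E, 11E/5, -11E/5`. -/
def levels (E : ℝ) : Fin 5 → ℝ := ![0, E, -E, 11 * E / 5, -(11 * E / 5)]

/-- The five-level Hamiltonian `H_e` with the energies `0, ±ħ, ±11ħ/5`. -/
def exampleHamiltonian (ħ : ℝ) : Hamiltonian (Fin 5) (EuclideanSpace ℂ (Fin 5)) where
  basis := (EuclideanSpace.basisFun (Fin 5) ℂ).toHilbertBasis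
  energy := levels ħ

/-- The state `φ_e = [√7 |0⟩ + √2 (|ħ⟩ + |-ħ⟩ + |11ħ/5⟩ + |-11ħ/5⟩)] / √15`. -/
def exampleState : EuclideanSpace ℂ (Fin 5) :=
  ((Real.sqrt 15 : ℂ)⁻¹) • !₂[(Real.sqrt 7 : ℂ), (Real.sqrt 2 : ℂ), (Real.sqrt 2 : ℂ),
    (Real.sqrt 2 : ℂ), (Real.sqrt 2 : ℂ)]

/-- The root fidelity `√F(t) = |⟨φ_e(0)|φ_e(t)⟩|` of the example. -/
def exampleRootFidelity (ħ t : ℝ) : ℝ :=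
  Real.sqrt ((exampleHamiltonian ħ).fidelity ħ exampleState t)

/-- `p` agrees with the cosine at `x` in the derivatives of order `0, …, m - 1`. -/
def MatchesCos (p : Polynomial ℝ) (m : ℕ) (x : ℝ) : Prop :=
  ∀ j < m, (Polynomial.derivative^[j] p).eval x = iteratedDeriv j Real.cos x

/-- `p` is the Hermite interpolating polynomial `p_e` of the cosine (35 conditions, degree at
most 34) for the interpolation times `τ₁`, `τ₂`. -/
structure IsHermiteInterpolant (τ₁ τ₂ : ℝ) (p : Polynomial ℝ) : Prop where
  natDegree_le : p.natDegree ≤ 34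
  at_zero : MatchesCos p 3 0
  at_first : MatchesCos p 4 τ₁ ∧ MatchesCos p 4 (-τ₁)
  at_second : MatchesCos p 2 τ₂ ∧ MatchesCos p 2 (-τ₂)
  at_scaled_first : MatchesCos p 6 (11 * τ₁ / 5) ∧ MatchesCos p 6 (-(11 * τ₁ / 5))
  at_scaled_second : MatchesCos p 4 (11 * τ₂ / 5) ∧ MatchesCos p 4 (-(11 * τ₂ / 5))

/-- The data of the degree-34 quantum speed limit: `τ₁ ≈ 9.693` is the first time at which the
root fidelity of the example vanishes, `τ₂ ≈ 4.110` is the time of its local minimum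
`√F ≈ 0.0682`, and `p` is the interpolating polynomial `p_e` for these times. -/
structure IsQSLData (ħ τ₁ τ₂ : ℝ) (p : Polynomial ℝ) : Prop where
  first : IsLeast {t : ℝ | 0 ≤ t ∧ exampleRootFidelity ħ t = 0} τ₁
  second : IsLocalMin (exampleRootFidelity ħ) τ₂
  second_approx : |τ₂ - 4.110| ≤ 0.0005
  interpolant : IsHermiteInterpolant τ₁ τ₂ p

end QSL

end

/-! The heart of the matter is that `p ≤ cos` on the whole line, with equality only at the
interpolation points (`isHermiteInterpolant_le_cos`). By uniqueness of Hermite interpolation, `p(x)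
= q(x²)`, where `q` has degree at most 17 and interpolates `f(y) = cos √y` at 18 nodes `y = x²`, all
of even multiplicity. The node polynomial `W` is therefore nonnegative, and the usual remainder
`f⁽¹⁸⁾(ξ) W(y) / 18!` would settle the claim if `f⁽¹⁸⁾` were positive everywhere. It is shown to be
positive on `[0, 460]`, which contains the nodes but not every `y ≥ 0`.

The remaining `y` are handled in `eval_lt_cosSqrt`. If `q(y) ≥ f(y)` off the nodes, some `l ≤ 0`
makes `f - q - l W` vanish at 19 points, so by Rolle its 17th derivative, `f⁽¹⁷⁾` plus an affine
function, has two zeros. On `[0, 460]` this derivative is strictly increasing. Beyond 460 it is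
positive, because `f⁽¹⁷⁾` is small there compared with the leading coefficient of `q`, which
convexity of `-f⁽¹⁷⁾` bounds away from zero (`cosSqrt_le_leading_coeff`).

For a magic state, the moments force the energies to be `0, ±ħ, ±11ħ/5` and fix the weight of each
`|E|`. Hence the bound is the average of `p` at `0, τ, 11τ/5` with weights `7/15, 4/15, 4/15`, and
the real part of the overlap is the same average of `cos`. Both vanish, so `p` touches `cos` at `τ`
and at `11τ/5`, and the list of nodes leaves only `τ = τ₁`. The imaginary part of the overlap,
together with `|sin τ₁| < |sin (11τ₁/5)|`, prevents either extreme level from being empty. -/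

/-! ### The derivatives of `cos √y` -/

/-- The coefficients of the power series of `cosSqrt n`. -/
noncomputable def cosSqrtCoeff (n k : ℕ) : ℝ :=
  (k + n).factorial / (k.factorial * (2 * k + 2 * n).factorial)

/-- Up to the sign `(-1)^n`, the `n`-th derivative of the entire function `y ↦ cos √y`. -/
noncomputable def cosSqrt (n : ℕ) (y : ℝ) : ℝ :=
  ∑' k : ℕ, (-1) ^ k * cosSqrtCoeff n k * y ^ k

theorem cosSqrtCoeff_pos (n k : ℕ) : 0 < cosSqrtCoeff n k := by
  unfold cosSqrtCoeff; positivity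

theorem cosSqrtCoeff_succ_right (n k : ℕ) :
    (k + 1) * (4 * k + 4 * n + 2) * cosSqrtCoeff n (k + 1) = cosSqrtCoeff n k := by
  unfold cosSqrtCoeff
  rw [show k + 1 + n = (k + n) + 1 by ring,
    show 2 * (k + 1) + 2 * n = (2 * k + 2 * n) + 1 + 1 by ring]
  simp only [Nat.factorial_succ]
  push_cast
  field_simp
  ring

theorem cosSqrtCoeff_succ_left (n k : ℕ) :
    cosSqrtCoeff (n + 1) k = (k + 1) * cosSqrtCoeff n (k + 1) := by
  unfold cosSqrtCoeff
  rw [show k + 1 + n = k + (n + 1) by ring,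
    show 2 * (k + 1) + 2 * n = 2 * k + 2 * (n + 1) by ring]
  simp only [Nat.factorial_succ]
  push_cast
  field_simp

theorem cosSqrtCoeff_le (n k : ℕ) :
    cosSqrtCoeff n k ≤ cosSqrtCoeff n 0 * ((4 * n + 2 : ℝ)⁻¹ ^ k / k.factorial) := by
  induction k with
  | zero => simp
  | succ k ih =>
    have h := cosSqrtCoeff_succ_right n k
    have hp := cosSqrtCoeff_pos n (k + 1)
    have h1 : (k + 1) * (4 * n + 2) * cosSqrtCoeff n (k + 1) ≤ cosSqrtCoeff n k := by
      rw [← h]; gcongr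
      nlinarith [(Nat.cast_nonneg k : (0 : ℝ) ≤ k)]
    have h2 : cosSqrtCoeff n (k + 1) ≤ cosSqrtCoeff n k / ((k + 1) * (4 * n + 2)) := by
      rw [le_div_iff₀ (by positivity)]; linarith
    refine h2.trans ?_
    rw [div_le_iff₀ (by positivity)]
    refine ih.trans (le_of_eq ?_)
    rw [Nat.factorial_succ, pow_succ]
    push_cast
    field_simp

theorem norm_cosSqrt_term_le (n k : ℕ) (y : ℝ) :
    ‖(-1) ^ k * cosSqrtCoeff n k * y ^ k‖ ≤
      cosSqrtCoeff n 0 * ((|y| / (4 * n + 2)) ^ k / k.factorial) := by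
  rw [norm_mul, norm_mul, norm_pow, norm_neg, norm_one, one_pow, one_mul, norm_pow,
    Real.norm_of_nonneg (cosSqrtCoeff_pos n k).le, Real.norm_eq_abs]
  calc _ ≤ cosSqrtCoeff n 0 * ((4 * n + 2 : ℝ)⁻¹ ^ k / k.factorial) * |y| ^ k := by
        gcongr; exact cosSqrtCoeff_le n k
    _ = _ := by rw [div_eq_mul_inv |y|, mul_pow]; ring

theorem hasSum_cosSqrt_bound (n : ℕ) (y : ℝ) :
    HasSum (fun k : ℕ => cosSqrtCoeff n 0 * ((|y| / (4 * n + 2)) ^ k / k.factorial))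
      (cosSqrtCoeff n 0 * Real.exp (|y| / (4 * n + 2))) := by
  have h := NormedSpace.expSeries_div_hasSum_exp (|y| / (4 * n + 2 : ℝ))
  rw [← Real.exp_eq_exp_ℝ] at h
  exact h.mul_left _

theorem summable_cosSqrt (n : ℕ) (y : ℝ) :
    Summable fun k : ℕ => (-1) ^ k * cosSqrtCoeff n k * y ^ k :=
  .of_norm_bounded (hasSum_cosSqrt_bound n y).summable fun k => norm_cosSqrt_term_le n k y

theorem abs_cosSqrt_le (n : ℕ) (y : ℝ) :
    |cosSqrt n y| ≤ cosSqrtCoeff n 0 * Real.exp (|y| / (4 * n + 2)) :=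
  tsum_of_norm_bounded (hasSum_cosSqrt_bound n y) fun k => norm_cosSqrt_term_le n k y

theorem cosSqrt_zero_right (n : ℕ) : cosSqrt n 0 = cosSqrtCoeff n 0 := by
  unfold cosSqrt
  rw [tsum_eq_single 0 fun k hk => by simp [hk]]
  simp

theorem hasDerivAt_cosSqrt (n : ℕ) (y : ℝ) :
    HasDerivAt (cosSqrt n) (-cosSqrt (n + 1) y) y := by
  have hterm : ∀ (k : ℕ) (z : ℝ), HasDerivAt (fun z => (-1) ^ k * cosSqrtCoeff n k * z ^ k)
      ((-1) ^ k * cosSqrtCoeff n k * (k * z ^ (k - 1))) z := fun k z =>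
    (hasDerivAt_pow k z).const_mul _
  have hshift : ∀ (k : ℕ) (z : ℝ),
      (-1) ^ (k + 1) * cosSqrtCoeff n (k + 1) * ((k + 1 : ℕ) * z ^ (k + 1 - 1)) =
        -((-1) ^ k * cosSqrtCoeff (n + 1) k * z ^ k) := fun k z => by
    rw [cosSqrtCoeff_succ_left, Nat.add_sub_cancel]
    push_cast
    ring
  -- A majorant of the differentiated series on the ball of radius `|y| + 1`; shifted by one, it is
  -- the series of `cosSqrt (n + 1)` at `-(|y| + 1)`, where all terms are positive.
  let u : ℕ → ℝ := fun k => cosSqrtCoeff n k * (k * (|y| + 1) ^ (k - 1))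
  have hu : Summable u := by
    rw [← summable_nat_add_iff 1]
    refine (summable_cosSqrt (n + 1) (-(|y| + 1))).congr fun k => ?_
    simp only [u]
    rw [cosSqrtCoeff_succ_left, Nat.add_sub_cancel, neg_pow (|y| + 1)]
    have : ((-1 : ℝ) ^ k) * (-1) ^ k = 1 := by rw [← mul_pow]; simp
    push_cast
    linear_combination (↑k + 1) * cosSqrtCoeff n (k + 1) * (|y| + 1) ^ k * this
  have key := hasDerivAt_tsum_of_isPreconnected (t := Metric.ball (0 : ℝ) (|y| + 1)) hu
    Metric.isOpen_ball (convex_ball _ _).isPreconnected (fun k z _ => hterm k z)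
    (fun k z hz => by
      simp only [u]
      rw [norm_mul, norm_mul, norm_pow, norm_neg, norm_one, one_pow, one_mul, norm_mul, norm_pow,
        Real.norm_of_nonneg (cosSqrtCoeff_pos n k).le, Real.norm_natCast]
      have : ‖z‖ ≤ |y| + 1 := by simpa using (Metric.mem_ball.1 hz).le
      have := (cosSqrtCoeff_pos n k).le
      gcongr)
    (Metric.mem_ball_self (by positivity)) (summable_cosSqrt n 0)
    (show y ∈ Metric.ball (0 : ℝ) (|y| + 1) by simp)
  refine HasDerivAt.congr_deriv key ?_
  have hs : Summable fun k : ℕ => (-1) ^ k * cosSqrtCoeff n k * (k * y ^ (k - 1)) := by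
    rw [← summable_nat_add_iff 1]
    exact (summable_cosSqrt (n + 1) y).neg.congr fun k => (hshift k y).symm
  rw [hs.tsum_eq_zero_add]
  simp only [hshift, tsum_neg]
  simp [cosSqrt]

/-- For `n = 0` this is the differential equation `4y f'' + 2f' + f = 0` of `f(y) = cos √y`; the
general case is its `n`-th derivative. -/
theorem cosSqrt_recurrence (n : ℕ) (y : ℝ) :
    cosSqrt n y = (4 * n + 2) * cosSqrt (n + 1) y - 4 * y * cosSqrt (n + 2) y := by
  have h1 := (summable_cosSqrt (n + 1) y).hasSum.mul_left (4 * n + 2 : ℝ)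
  have h2 : HasSum (fun k : ℕ => 4 * k * ((-1) ^ k * cosSqrtCoeff (n + 1) k * y ^ k))
      (-(4 * y * cosSqrt (n + 2) y)) := by
    rw [← hasSum_nat_add_iff' 1]
    have h3 := (summable_cosSqrt (n + 2) y).hasSum.mul_left (-(4 * y))
    simp only [Finset.range_one, Finset.sum_singleton, Nat.cast_zero, mul_zero, zero_mul, sub_zero]
    rw [← neg_mul]
    refine h3.congr_fun ?_
    intro k
    rw [cosSqrtCoeff_succ_left (n + 1) k]
    push_cast
    ring
  have h3 := h1.add h2
  rw [← sub_eq_add_neg] at h3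
  refine ((summable_cosSqrt n y).hasSum.unique ?_)
  refine h3.congr_fun ?_
  intro k
  rw [← cosSqrtCoeff_succ_right n k, cosSqrtCoeff_succ_left n k]
  ring

theorem cosSqrt_zero_sq (x : ℝ) : cosSqrt 0 (x ^ 2) = Real.cos x := by
  refine (Real.hasSum_cos x).unique ?_ |>.symm
  refine (summable_cosSqrt 0 (x ^ 2)).hasSum.congr_fun ?_
  intro k
  unfold cosSqrtCoeff
  simp only [add_zero, mul_zero]
  rw [← pow_mul]
  field_simp

theorem iteratedDeriv_cosSqrt (n m : ℕ) :
    iteratedDeriv m (cosSqrt n) = fun y => (-1) ^ m * cosSqrt (n + m) y := by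
  induction m with
  | zero => simp
  | succ m ih =>
    rw [iteratedDeriv_succ, ih]
    funext y
    rw [((hasDerivAt_cosSqrt (n + m) y).const_mul _).deriv, pow_succ, ← add_assoc]
    ring

theorem contDiff_cosSqrt (n : ℕ) : ContDiff ℝ (⊤ : ℕ∞) (cosSqrt n) := by
  refine contDiff_of_differentiable_iteratedDeriv fun m _ => ?_
  rw [iteratedDeriv_cosSqrt]
  exact fun y => ((hasDerivAt_cosSqrt (n + m) y).const_mul _).differentiableAt

attribute [irreducible] cosSqrtCoeff cosSqrt

theorem deriv_cosSqrt (n : ℕ) : deriv (cosSqrt n) = fun y => -cosSqrt (n + 1) y :=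
  funext fun y => (hasDerivAt_cosSqrt n y).deriv

theorem differentiable_cosSqrt (n : ℕ) : Differentiable ℝ (cosSqrt n) :=
  fun y => (hasDerivAt_cosSqrt n y).differentiableAt

/-- The slope is at most `e < 3` times `cosSqrt (n + 1) 0 = cosSqrt n 0 / (4n + 2)`, so at most half
of the initial value is lost on `[0, Y]`. -/
theorem half_le_cosSqrt {n : ℕ} {Y y : ℝ} (hn : 6 * Y ≤ 4 * n + 2) (hy : y ∈ Set.Icc 0 Y) :
    cosSqrtCoeff n 0 / 2 ≤ cosSqrt n y := by
  have hY : 0 ≤ Y := hy.1.trans hy.2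
  have hpos := cosSqrtCoeff_pos (n + 1) 0
  have hbd : ∀ x ∈ Set.Icc 0 Y, ‖deriv (cosSqrt n) x‖ ≤ 3 * cosSqrtCoeff (n + 1) 0 := by
    intro x hx
    rw [deriv_cosSqrt, norm_neg, Real.norm_eq_abs]
    refine (abs_cosSqrt_le (n + 1) x).trans ?_
    rw [mul_comm]
    gcongr
    refine le_trans (Real.exp_le_exp.2 (?_ : _ ≤ (1 : ℝ)))
      (Real.exp_one_lt_d9.le.trans (by norm_num))
    rw [div_le_one (by positivity), abs_of_nonneg hx.1]
    push_cast
    linarith [hx.2]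
  have h := (convex_Icc 0 Y).norm_image_sub_le_of_norm_deriv_le
    (fun x _ => differentiable_cosSqrt n x) hbd ⟨le_rfl, hY⟩ hy
  rw [cosSqrt_zero_right, Real.norm_eq_abs, sub_zero, Real.norm_of_nonneg hy.1] at h
  have h1 := (abs_le.1 h).1
  have h2 := cosSqrtCoeff_succ_left n 0
  have h3 := cosSqrtCoeff_succ_right n 0
  norm_num at h2 h3
  have h4 : 6 * y * cosSqrtCoeff (n + 1) 0 ≤ (4 * n + 2) * cosSqrtCoeff (n + 1) 0 := by
    gcongr; linarith [hy.2]
  rw [h2] at h1 h4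
  linarith

theorem cosSqrt_ratio_of_large {n : ℕ} {Y y : ℝ} (hn : 6 * Y ≤ 4 * n + 2)
    (hy : y ∈ Set.Icc 0 Y) :
    0 < cosSqrt (n + 1) y ∧ (2 * n + 1) * cosSqrt (n + 1) y ≤ cosSqrt n y := by
  have hY : 0 ≤ Y := hy.1.trans hy.2
  have hpos : ∀ (k : ℕ), n ≤ k → ∀ x ∈ Set.Icc 0 Y, 0 < cosSqrt k x := fun k hk x hx => by
    have : (n : ℝ) ≤ k := by exact_mod_cast hk
    have := half_le_cosSqrt (n := k) (by linarith) hx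
    linarith [cosSqrtCoeff_pos k 0]
  refine ⟨hpos _ (by omega) y hy, ?_⟩
  have hanti : AntitoneOn (cosSqrt (n + 1)) (Set.Icc 0 Y) := by
    refine antitoneOn_of_deriv_nonpos (convex_Icc 0 Y)
      (differentiable_cosSqrt _).continuous.continuousOn
      (differentiable_cosSqrt _).differentiableOn fun x hx => ?_
    rw [interior_Icc] at hx
    rw [deriv_cosSqrt]
    linarith [hpos (n + 1 + 1) (by omega) x ⟨hx.1.le, hx.2.le⟩]
  have h1 := hanti ⟨le_rfl, hY⟩ hy hy.1
  rw [cosSqrt_zero_right] at h1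
  have h0 := half_le_cosSqrt hn hy
  have h2 := cosSqrtCoeff_succ_left n 0
  have h3 := cosSqrtCoeff_succ_right n 0
  norm_num at h2 h3
  rw [h2] at h1
  have h4 : (2 * n + 1) * cosSqrt (n + 1) y ≤ (2 * n + 1) * cosSqrtCoeff n 1 := by gcongr
  linarith

/-- Up to the square of its order, `cosSqrt n` is positive, and it dominates the next one. -/
theorem cosSqrt_ratio {N n : ℕ} {y : ℝ} (hn : N ≤ n) (hy : y ∈ Set.Icc 0 ((N + 1 / 2 : ℝ) ^ 2)) :
    0 < cosSqrt (n + 1) y ∧ (2 * n + 1) * cosSqrt (n + 1) y ≤ cosSqrt n y := by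
  obtain ⟨M, hM⟩ := exists_nat_ge (6 * (N + 1 / 2 : ℝ) ^ 2)
  have hM' : 6 * (N + 1 / 2 : ℝ) ^ 2 ≤ 4 * (max M n : ℕ) + 2 := by
    have : (M : ℝ) ≤ (max M n : ℕ) := by exact_mod_cast le_max_left M n
    linarith [(Nat.cast_nonneg (max M n) : (0 : ℝ) ≤ _)]
  have hbase := cosSqrt_ratio_of_large hM' hy
  -- The recurrence expresses `cosSqrt k` through higher orders, so the estimate descends from an
  -- order that is large compared with `y`. Each step needs only `4y ≤ (2k + 1)²`.
  refine Nat.decreasingInduction' (P := fun n => 0 < cosSqrt (n + 1) y ∧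
    (2 * n + 1) * cosSqrt (n + 1) y ≤ cosSqrt n y) ?_ (le_max_right M n) hbase
  intro k _ hk ⟨h1, h2⟩
  push_cast at h2
  have hpos : 0 < cosSqrt (k + 1) y := by
    refine lt_of_lt_of_le ?_ h2
    positivity
  refine ⟨hpos, ?_⟩
  have hNk : (N : ℝ) ≤ k := by exact_mod_cast hn.trans hk
  have hyk : 4 * y ≤ (2 * k + 1) ^ 2 := by
    have : (N + 1 / 2 : ℝ) ^ 2 ≤ (k + 1 / 2) ^ 2 := by gcongr
    nlinarith [hy.2]
  have h3 : 4 * y * cosSqrt (k + 2) y ≤ (2 * k + 1) ^ 2 * cosSqrt (k + 2) y :=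
    mul_le_mul_of_nonneg_right hyk h1.le
  have h4 : (2 * k + 1) * ((2 * (k + 1) + 1) * cosSqrt (k + 2) y) ≤
      (2 * k + 1) * cosSqrt (k + 1) y :=
    mul_le_mul_of_nonneg_left h2 (by positivity)
  have h5 : 0 ≤ (2 * k + 1) * cosSqrt (k + 2) y := mul_nonneg (by positivity) h1.le
  rw [cosSqrt_recurrence k]
  nlinarith

/-- As `460 < 21.5²`, `cosSqrt_ratio` applies at order 21. Three applications of the recurrence then
carry positivity down to order 18, with ratios that deteriorate from 43 to 39, 30.8 and 14. -/
theorem cosSqrt_ratio_eighteen {y : ℝ} (hy : y ∈ Set.Icc (0 : ℝ) 460) :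
    0 < cosSqrt 19 y ∧ 14 * cosSqrt 19 y ≤ cosSqrt 18 y := by
  obtain ⟨h22, h21⟩ := cosSqrt_ratio (N := 21) (n := 21) le_rfl
    (⟨hy.1, hy.2.trans (by norm_num)⟩ : y ∈ Set.Icc (0 : ℝ) (((21 : ℕ) + 1 / 2 : ℝ) ^ 2))
  have e20 := cosSqrt_recurrence 20 y
  have e19 := cosSqrt_recurrence 19 y
  have e18 := cosSqrt_recurrence 18 y
  norm_num at h22 h21 e20 e19 e18
  have p21 : 0 < cosSqrt 21 y := by linarith
  have h20 : 39 * cosSqrt 21 y ≤ cosSqrt 20 y := by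
    have := mul_le_mul_of_nonneg_right hy.2 h22.le
    linarith
  have p20 : 0 < cosSqrt 20 y := by linarith
  have h19 : 30.8 * cosSqrt 20 y ≤ cosSqrt 19 y := by
    have := mul_le_mul_of_nonneg_right hy.2 p21.le
    linarith
  have := mul_le_mul_of_nonneg_right hy.2 p20.le
  constructor <;> linarith

theorem cosSqrt_eighteen_pos {y : ℝ} (hy : y ∈ Set.Icc (0 : ℝ) 460) : 0 < cosSqrt 18 y := by
  have := cosSqrt_ratio_eighteen hy
  linarith

theorem strictAntiOn_cosSqrt_seventeen : StrictAntiOn (cosSqrt 17) (Set.Icc 0 460) := by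
  refine strictAntiOn_of_deriv_neg (convex_Icc _ _)
    (differentiable_cosSqrt _).continuous.continuousOn fun x hx => ?_
  rw [interior_Icc] at hx
  rw [deriv_cosSqrt]
  linarith [cosSqrt_eighteen_pos ⟨hx.1.le, hx.2.le⟩]

theorem antitoneOn_cosSqrt_eighteen : AntitoneOn (cosSqrt 18) (Set.Icc 0 460) := by
  refine antitoneOn_of_deriv_nonpos (convex_Icc _ _)
    (differentiable_cosSqrt _).continuous.continuousOn
    (differentiable_cosSqrt _).differentiableOn fun x hx => ?_
  rw [interior_Icc] at hx
  rw [deriv_cosSqrt]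
  linarith [(cosSqrt_ratio_eighteen (y := x) ⟨hx.1.le, hx.2.le⟩).1]

/-- A convex function lies above its tangents: the slope `-cosSqrt 18` increases on `[0, 460]`. -/
theorem cosSqrt_seventeen_tangent {x y : ℝ} (hx : x ∈ Set.Icc (0 : ℝ) 460)
    (hy : y ∈ Set.Icc (0 : ℝ) 460) :
    cosSqrt 17 y - cosSqrt 18 y * (x - y) ≤ cosSqrt 17 x := by
  rcases lt_trichotomy x y with h | rfl | h
  · obtain ⟨c, hc, he⟩ := exists_hasDerivAt_eq_slope (cosSqrt 17) _ h
      (differentiable_cosSqrt _).continuous.continuousOn fun z _ => hasDerivAt_cosSqrt 17 z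
    rw [eq_div_iff (by linarith)] at he
    have := antitoneOn_cosSqrt_eighteen ⟨hx.1.trans hc.1.le, hc.2.le.trans hy.2⟩ hy hc.2.le
    norm_num at he
    nlinarith
  · simp
  · obtain ⟨c, hc, he⟩ := exists_hasDerivAt_eq_slope (cosSqrt 17) _ h
      (differentiable_cosSqrt _).continuous.continuousOn fun z _ => hasDerivAt_cosSqrt 17 z
    rw [eq_div_iff (by linarith)] at he
    have := antitoneOn_cosSqrt_eighteen hy ⟨hy.1.trans hc.1.le, hc.2.le.trans hx.2⟩ hc.1.le
    norm_num at he
    nlinarith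

/-- By the recurrence the derivative collapses to `-8n cosSqrt (n + 1) y ^ 2`. This energy controls
`cosSqrt n` in the oscillating range, where signs are no longer known. -/
theorem cosSqrt_energy_antitone (n : ℕ) :
    Antitone fun y => cosSqrt n y ^ 2 + 4 * y * cosSqrt (n + 1) y ^ 2 := by
  refine antitone_of_hasDerivAt_nonpos (f' := fun y => -(8 * n * cosSqrt (n + 1) y ^ 2)) ?_ ?_
  · intro y
    refine (((hasDerivAt_cosSqrt n y).pow 2).add
      (((hasDerivAt_id y).const_mul 4).mul ((hasDerivAt_cosSqrt (n + 1) y).pow 2))).congr_deriv ?_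
    simp only [id, Pi.pow_apply]
    rw [cosSqrt_recurrence n y]
    push_cast
    ring
  · intro y
    simp only [Pi.zero_apply]
    have : 0 ≤ 8 * n * cosSqrt (n + 1) y ^ 2 := by positivity
    linarith

/-- Both sides are compared with `b = cosSqrt 18 460`. The energy gives `|cosSqrt 17 z| ≤ 83 b`,
since `70² + 4 · 460 ≤ 83²`. On the other side `cosSqrt 17 195 ≥ 35 cosSqrt 18 195`, and the mean
value theorem on `[195, 460]` gives `cosSqrt 18 195 ≥ (1 + 265/74) b`. -/
theorem abs_cosSqrt_seventeen_lt {z : ℝ} (hz : 460 ≤ z) :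
    |cosSqrt 17 z| < cosSqrt 17 195 := by
  have hE := cosSqrt_energy_antitone 17 hz
  have hY : (460 : ℝ) ∈ Set.Icc (0 : ℝ) 460 := by norm_num
  have h0 : (195 : ℝ) ∈ Set.Icc (0 : ℝ) 460 := by norm_num
  obtain ⟨p19, h18⟩ := cosSqrt_ratio_eighteen hY
  have e17 := cosSqrt_recurrence 17 460
  norm_num at hE e17
  have hz17 : cosSqrt 17 z ^ 2 ≤ (83 * cosSqrt 18 460) ^ 2 := by
    have h1 : 0 ≤ 4 * z * cosSqrt 18 z ^ 2 := by positivity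
    have h2 : cosSqrt 17 460 ^ 2 ≤ (70 * cosSqrt 18 460) ^ 2 := by
      refine sq_le_sq' ?_ ?_ <;> linarith
    nlinarith [sq_nonneg (cosSqrt 18 460)]
  have p18 := cosSqrt_eighteen_pos hY
  have hz17' := abs_le_of_sq_le_sq hz17 (by positivity)
  obtain ⟨c, hc, he⟩ := exists_hasDerivAt_eq_slope (cosSqrt 18) _ (show (195 : ℝ) < 460 by norm_num)
      (differentiable_cosSqrt _).continuous.continuousOn fun z _ => hasDerivAt_cosSqrt 18 z
  have hc' : c ∈ Set.Icc (0 : ℝ) 460 := ⟨by linarith [hc.1], hc.2.le⟩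
  have hmono := antitoneOn_cosSqrt_eighteen hc' hY hc.2.le
  have p20 := (cosSqrt_ratio (N := 21) (n := 19 + 2) (by norm_num)
    (⟨hc'.1, hc'.2.trans (by norm_num)⟩ : c ∈ Set.Icc (0 : ℝ) (((21 : ℕ) + 1 / 2 : ℝ) ^ 2)))
  have e18 := cosSqrt_recurrence 18 c
  have e20 := cosSqrt_recurrence 20 c
  have hq20 : 0 ≤ cosSqrt 20 c := by
    norm_num at p20 e20
    have := mul_le_mul_of_nonneg_right hc'.2 p20.1.le
    linarith
  have hq := mul_nonneg hc'.1 hq20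
  have h17 := (cosSqrt_ratio (N := 14) (n := 17) (by norm_num)
    (⟨h0.1, by norm_num⟩ : (195 : ℝ) ∈ Set.Icc (0 : ℝ) (((14 : ℕ) + 1 / 2 : ℝ) ^ 2))).2
  norm_num at he e18 h17
  linarith

/-! ### Rolle's theorem with multiplicities -/

/-- The function `f` vanishes at every point of the multiset `s`, to an order which is at least the
multiplicity of the point. -/
def VanishesOn (f : ℝ → ℝ) (s : Multiset ℝ) : Prop :=
  ∀ x j, j < s.count x → iteratedDeriv j f x = 0

theorem exists_finset_deriv_eq_zero {f : ℝ → ℝ} (hf : Differentiable ℝ f) (S : Finset ℝ) :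
    (∀ x ∈ S, f x = 0) → S.Nonempty → ∃ T : Finset ℝ, T.card + 1 = S.card ∧
      ∀ t ∈ T, t ∉ S ∧ deriv f t = 0 ∧ (∃ a ∈ S, a < t) ∧ ∃ b ∈ S, t < b := by
  induction S using Finset.induction_on_max with
  | empty => simp
  | insert a S ha ih =>
    intro hS _
    rcases S.eq_empty_or_nonempty with rfl | hne
    · exact ⟨∅, by simp⟩
    obtain ⟨T, hcard, hT⟩ := ih (fun x hx => hS x (Finset.mem_insert_of_mem hx)) hne
    have hbS := S.max'_mem hne
    set b := S.max' hne with hb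
    obtain ⟨c, hc, hc0⟩ := exists_deriv_eq_zero (ha b hbS) hf.continuous.continuousOn
      ((hS b (Finset.mem_insert_of_mem hbS)).trans (hS a (Finset.mem_insert_self _ _)).symm)
    have hcS : ∀ x ∈ S, x < c := fun x hx => (S.le_max' x hx).trans_lt hc.1
    have hcT : c ∉ T := fun h => by
      obtain ⟨-, -, -, d, hd, hcd⟩ := hT c h
      exact (hcS d hd).not_gt hcd
    have haS : a ∉ S := fun h => (ha a h).false
    refine ⟨insert c T, ?_, ?_⟩
    · rw [Finset.card_insert_of_notMem hcT, Finset.card_insert_of_notMem haS, hcard]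
    · intro t ht
      rcases Finset.mem_insert.1 ht with rfl | ht
      · refine ⟨fun h => ?_, hc0, ⟨b, Finset.mem_insert_of_mem hbS, hc.1⟩,
          a, Finset.mem_insert_self _ _, hc.2⟩
        rcases Finset.mem_insert.1 h with rfl | h
        · exact hc.2.false
        · exact (hcS _ h).false
      · obtain ⟨h1, h2, ⟨u, hu, hut⟩, v, hv, htv⟩ := hT t ht
        refine ⟨fun h => ?_, h2, ⟨u, Finset.mem_insert_of_mem hu, hut⟩,
          v, Finset.mem_insert_of_mem hv, htv⟩
        rcases Finset.mem_insert.1 h with rfl | h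
        · exact (ha v hv).not_gt htv
        · exact h1 h

theorem VanishesOn.exists_deriv {f : ℝ → ℝ} (hf : Differentiable ℝ f) {s : Multiset ℝ}
    (hs : VanishesOn f s) {I : Set ℝ} (hI : I.OrdConnected) (hsI : ∀ x ∈ s, x ∈ I) {n : ℕ}
    (hn : s.card = n + 1) :
    ∃ s' : Multiset ℝ, s'.card = n ∧ (∀ x ∈ s', x ∈ I) ∧ VanishesOn (deriv f) s' := by
  obtain ⟨T, hcard, hT⟩ := exists_finset_deriv_eq_zero hf s.toFinset
    (fun x hx => by
      simpa using hs x 0 (Multiset.count_pos.2 (Multiset.mem_toFinset.1 hx)))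
    (by
      obtain ⟨x, hx⟩ := Multiset.card_pos_iff_exists_mem.1 (by omega : 0 < s.card)
      exact ⟨x, Multiset.mem_toFinset.2 hx⟩)
  have hle : s.toFinset.val ≤ s := by
    rw [Multiset.toFinset_val]; exact Multiset.dedup_le s
  -- Every multiplicity drops by one, and the `d` distinct zeros contribute `d - 1` new ones
  -- strictly between them. The new ones are not old zeros, so multiplicities never have to be
  -- added.
  refine ⟨s - s.toFinset.val + T.val, ?_, ?_, ?_⟩
  · have h1 := Multiset.card_le_card hle
    rw [Multiset.card_add, Multiset.card_sub hle]
    simp only [Finset.card_val] at *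
    omega
  · intro x hx
    rcases Multiset.mem_add.1 hx with hx | hx
    · exact hsI x (Multiset.mem_of_le (Multiset.sub_le_self _ _) hx)
    · obtain ⟨-, -, ⟨a, ha, hax⟩, b, hb, hxb⟩ := hT x hx
      exact hI.out (hsI a (Multiset.mem_toFinset.1 ha)) (hsI b (Multiset.mem_toFinset.1 hb))
        ⟨hax.le, hxb.le⟩
  · intro x j hj
    rw [Multiset.count_add, Multiset.count_sub] at hj
    by_cases hxT : x ∈ T
    · obtain ⟨hxS, hx0, -⟩ := hT x hxT
      have hxs : s.count x = 0 := Multiset.count_eq_zero.2 fun h => hxS (Multiset.mem_toFinset.2 h)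
      have hx1 := Multiset.count_eq_one_of_mem T.nodup hxT
      have : j = 0 := by omega
      subst this
      simpa using hx0
    · have hx0 : T.val.count x = 0 := Multiset.count_eq_zero.2 hxT
      rw [← iteratedDeriv_succ']
      refine hs x (j + 1) ?_
      by_cases hxs : x ∈ s
      · have := Multiset.count_eq_one_of_mem s.toFinset.nodup (Multiset.mem_toFinset.2 hxs)
        omega
      · have := Multiset.count_eq_zero.2 hxs
        omega

/-- Rolle's theorem for zeros with multiplicities. -/
theorem VanishesOn.exists_iteratedDeriv {f : ℝ → ℝ} (hf : ContDiff ℝ (⊤ : ℕ∞) f)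
    {s : Multiset ℝ} (hs : VanishesOn f s) {I : Set ℝ} (hI : I.OrdConnected)
    (hsI : ∀ x ∈ s, x ∈ I) (m : ℕ) {n : ℕ} (hn : s.card = n + m) :
    ∃ s' : Multiset ℝ, s'.card = n ∧ (∀ x ∈ s', x ∈ I) ∧ VanishesOn (iteratedDeriv m f) s' := by
  induction m generalizing n with
  | zero => exact ⟨s, by simpa using hn, hsI, by simpa using hs⟩
  | succ m ih =>
    obtain ⟨s₁, h1, h2, h3⟩ := ih (n := n + 1) (by omega)
    obtain ⟨s₂, h4, h5, h6⟩ := h3.exists_deriv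
      (hf.differentiable_iteratedDeriv m (by exact_mod_cast ENat.natCast_lt_top m)) hI h2 h1
    exact ⟨s₂, h4, h5, by rwa [iteratedDeriv_succ]⟩

theorem VanishesOn.exists_iteratedDeriv_eq_zero {f : ℝ → ℝ} (hf : ContDiff ℝ (⊤ : ℕ∞) f)
    {s : Multiset ℝ} (hs : VanishesOn f s) {I : Set ℝ} (hI : I.OrdConnected)
    (hsI : ∀ x ∈ s, x ∈ I) {m : ℕ} (hm : s.card = m + 1) :
    ∃ x ∈ I, iteratedDeriv m f x = 0 := by
  obtain ⟨s', h1, h2, h3⟩ := hs.exists_iteratedDeriv hf hI hsI m (n := 1) (by omega)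
  obtain ⟨x, rfl⟩ := Multiset.card_eq_one.1 h1
  exact ⟨x, h2 x (by simp), by simpa using h3 x 0 (by simp)⟩

/-- A function with `m + 2` zeros has an `m`-th derivative with two zeros. -/
theorem VanishesOn.exists_iteratedDeriv_two {f : ℝ → ℝ} (hf : ContDiff ℝ (⊤ : ℕ∞) f)
    {s : Multiset ℝ} (hs : VanishesOn f s) {I : Set ℝ} (hI : I.OrdConnected)
    (hsI : ∀ x ∈ s, x ∈ I) {m : ℕ} (hm : s.card = m + 2) :
    ∃ x ∈ I, ∃ y ∈ I, iteratedDeriv m f x = 0 ∧ iteratedDeriv m f y = 0 ∧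
      (x < y ∨ deriv (iteratedDeriv m f) x = 0) := by
  obtain ⟨s', h1, h2, h3⟩ := hs.exists_iteratedDeriv hf hI hsI m (n := 2) (by omega)
  obtain ⟨x, y, rfl⟩ := Multiset.card_eq_two.1 h1
  have hx := h2 x (by simp)
  have hy := h2 y (by simp)
  have hx0 : iteratedDeriv m f x = 0 := by simpa using h3 x 0 (by simp)
  have hy0 : iteratedDeriv m f y = 0 := by
    simpa using h3 y 0 (Multiset.count_pos.2 (by simp))
  rcases lt_trichotomy x y with h | h | h
  · exact ⟨x, hx, y, hy, hx0, hy0, .inl h⟩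
  · subst h
    exact ⟨x, hx, x, hy, hx0, hy0, .inr (by simpa [iteratedDeriv_one] using h3 x 1 (by simp))⟩
  · exact ⟨y, hy, x, hx, hy0, hx0, .inl h⟩

/-! ### Hermite interpolation -/

open Polynomial in
theorem iteratedDeriv_polynomial_eval (p : ℝ[X]) (n : ℕ) :
    iteratedDeriv n (fun x => p.eval x) = fun x => (derivative^[n] p).eval x := by
  induction n with
  | zero => simp
  | succ n ih =>
    rw [iteratedDeriv_succ, ih, Function.iterate_succ_apply']
    funext x
    exact Polynomial.deriv _

theorem contDiff_polynomial_eval (p : Polynomial ℝ) :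
    ContDiff ℝ (⊤ : ℕ∞) fun x => p.eval x := by
  simpa using p.contDiff_aeval (R := ℝ) (𝕜 := ℝ) (⊤ : ℕ∞)

theorem iteratedDeriv_sub_polynomial {f : ℝ → ℝ} (hf : ContDiff ℝ (⊤ : ℕ∞) f)
    (p : Polynomial ℝ) (n : ℕ) (x : ℝ) :
    iteratedDeriv n (fun x => f x - p.eval x) x =
      iteratedDeriv n f x - (Polynomial.derivative^[n] p).eval x := by
  have hn : ((n : ℕ∞) : WithTop ℕ∞) ≤ (⊤ : ℕ∞) := by exact_mod_cast le_top
  rw [iteratedDeriv_fun_sub (hf.of_le hn).contDiffAt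
    ((contDiff_polynomial_eval p).of_le hn).contDiffAt, iteratedDeriv_polynomial_eval]

open Polynomial in
theorem polynomial_eq_zero_of_vanishesOn {p : ℝ[X]} {s : Multiset ℝ}
    (hs : VanishesOn (fun x => p.eval x) s) (hp : p.natDegree < s.card) : p = 0 := by
  by_contra h0
  have hle : s ≤ p.roots := by
    rw [Multiset.le_iff_count]
    intro x
    rw [count_roots]
    by_contra! hlt
    have hx := hs x
    simp only [iteratedDeriv_polynomial_eval] at hx
    exact (lt_rootMultiplicity_of_isRoot_iterate_derivative h0
      (fun m hm => hx m (hm.trans_lt hlt))).false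
  exact ((Multiset.card_le_card hle).trans p.card_roots').not_gt hp

/-- The monic polynomial with the roots `s`. -/
noncomputable def nodePoly (s : Multiset ℝ) : Polynomial ℝ :=
  (s.map fun a => Polynomial.X - Polynomial.C a).prod

theorem nodePoly_monic (s : Multiset ℝ) : (nodePoly s).Monic :=
  Polynomial.monic_multiset_prod_of_monic _ _ fun a _ => Polynomial.monic_X_sub_C a

theorem natDegree_nodePoly (s : Multiset ℝ) : (nodePoly s).natDegree = s.card :=
  Polynomial.natDegree_multiset_prod_X_sub_C_eq_card s

theorem rootMultiplicity_nodePoly (s : Multiset ℝ) (x : ℝ) :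
    (nodePoly s).rootMultiplicity x = s.count x := by
  rw [← Polynomial.count_roots, nodePoly, Polynomial.roots_multiset_prod_X_sub_C]

open Polynomial in
theorem nodePoly_derivative_eval (s : Multiset ℝ) {x : ℝ} {j : ℕ} (hj : j < s.count x) :
    (derivative^[j] (nodePoly s)).eval x = 0 :=
  isRoot_iterate_derivative_of_lt_rootMultiplicity (by rwa [rootMultiplicity_nodePoly])

open Polynomial in
theorem nodePoly_derivative_eval_ne_zero (s : Multiset ℝ) (x : ℝ) :
    (derivative^[s.count x] (nodePoly s)).eval x ≠ 0 := by
  rw [← rootMultiplicity_nodePoly, eval_iterate_derivative_rootMultiplicity]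
  refine smul_ne_zero (Nat.factorial_ne_zero _) ?_
  exact eval_divByMonic_pow_rootMultiplicity_ne_zero x (nodePoly_monic s).ne_zero

open Polynomial in
/-- Existence of the Hermite interpolating polynomial. -/
theorem exists_hermite_interpolant {f : ℝ → ℝ} (hf : ContDiff ℝ (⊤ : ℕ∞) f) (s : Multiset ℝ) :
    ∃ q : ℝ[X], q.degree < s.card ∧ VanishesOn (fun x => f x - q.eval x) s := by
  induction s using Multiset.induction_on with
  | empty => exact ⟨0, by simp, fun x j hj => by simp at hj⟩
  | cons a s ih =>
    obtain ⟨q, hq, hv⟩ := ih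
    set k := s.count a with hk
    set c := (iteratedDeriv k f a - (derivative^[k] q).eval a) /
      (derivative^[k] (nodePoly s)).eval a with hc
    -- Newton's step: `nodePoly s` preserves all earlier conditions, and its `k`-th derivative at
    -- `a` is nonzero, so `c` can be chosen to meet the one new condition.
    refine ⟨q + C c * nodePoly s, ?_, ?_⟩
    · rw [Multiset.card_cons]
      refine (degree_add_le _ _).trans_lt (max_lt (hq.trans (by exact_mod_cast Nat.lt_succ_self _)) ?_)
      rw [← smul_eq_C_mul]
      refine (degree_smul_le c _).trans_lt ?_
      rw [degree_eq_natDegree (nodePoly_monic s).ne_zero, natDegree_nodePoly]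
      exact_mod_cast Nat.lt_succ_self _
    · intro x j hj
      have hvx := hv x j
      rw [iteratedDeriv_sub_polynomial hf] at hvx ⊢
      rw [iterate_map_add, iterate_derivative_C_mul, eval_add, eval_mul, eval_C]
      by_cases hjs : j < s.count x
      · rw [nodePoly_derivative_eval s hjs]
        linarith [hvx hjs]
      · have hxa : x = a := by
          by_contra hne
          exact hjs (by rwa [Multiset.count_cons_of_ne hne] at hj)
        subst hxa
        rw [Multiset.count_cons_self] at hj
        have : j = k := by omega
        subst this
        rw [hc, div_mul_cancel₀ _ (nodePoly_derivative_eval_ne_zero s x)]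
        ring

open Polynomial in
theorem nodePoly_iterate_derivative (s : Multiset ℝ) {n : ℕ} (hn : s.card = n + 1) (x : ℝ) :
    (derivative^[n] (nodePoly s)).eval x = (n + 1).factorial * x - n.factorial * s.sum := by
  have hdeg : (derivative^[n] (nodePoly s)).natDegree ≤ 1 := by
    refine (natDegree_iterate_derivative _ _).trans ?_
    rw [natDegree_nodePoly]
    omega
  rw [eq_X_add_C_of_natDegree_le_one hdeg, coeff_iterate_derivative, coeff_iterate_derivative]
  have h1 : (nodePoly s).coeff (1 + n) = 1 := by
    have := (nodePoly_monic s).coeff_natDegree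
    rwa [natDegree_nodePoly, hn, add_comm] at this
  have h0 : (nodePoly s).coeff (0 + n) = -s.sum := by
    have h := multiset_prod_X_sub_C_coeff_card_pred s (by omega)
    rw [hn, Nat.add_sub_cancel] at h
    rw [zero_add]; exact h
  rw [h1, h0]
  have hd1 : (1 + n).descFactorial n = (n + 1).factorial := by
    have := Nat.factorial_mul_descFactorial (show n ≤ 1 + n by omega)
    rwa [Nat.add_sub_cancel, Nat.factorial_one, one_mul,
      show (1 + n).factorial = (n + 1).factorial by rw [add_comm]] at this
  rw [hd1, zero_add, Nat.descFactorial_self]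
  simp
  ring

open Polynomial in
theorem iterate_derivative_of_degree_lt {q : ℝ[X]} {n : ℕ} (hq : q.degree < (n + 1 : ℕ)) (x : ℝ) :
    (derivative^[n] q).eval x = n.factorial * q.coeff n := by
  have hq' : q.natDegree ≤ n := 
    natDegree_le_iff_coeff_eq_zero.2 fun k hk => (degree_lt_iff_coeff_zero q (n + 1)).1 hq k hk
  have hdeg : (derivative^[n] q).natDegree = 0 := by
    have := natDegree_iterate_derivative q n
    omega
  rw [eq_C_of_natDegree_eq_zero hdeg, coeff_iterate_derivative, zero_add, Nat.descFactorial_self]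
  simp

/-- The factor `u` closes the induction: the derivative of `u · (f ∘ g)` is a sum of two products of
the same shape, one with `f` and one with `f'`. -/
theorem iteratedDeriv_mul_comp_eq_zero {g : ℝ → ℝ} (hg : ContDiff ℝ (⊤ : ℕ∞) g) (x : ℝ) (n : ℕ) :
    ∀ {f u : ℝ → ℝ}, ContDiff ℝ (⊤ : ℕ∞) f → ContDiff ℝ (⊤ : ℕ∞) u →
      (∀ j ≤ n, iteratedDeriv j f (g x) = 0) → iteratedDeriv n (fun y => u y * f (g y)) x = 0 := by
  have hd : ∀ {f : ℝ → ℝ}, ContDiff ℝ (⊤ : ℕ∞) f → ContDiff ℝ (⊤ : ℕ∞) (deriv f) := fun hf =>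
    (contDiff_infty_iff_deriv.1 hf).2
  induction n with
  | zero =>
    intro f u _ _ h
    have := h 0 le_rfl
    simp only [iteratedDeriv_zero] at this ⊢
    rw [this, mul_zero]
  | succ n ih =>
    intro f u hf hu h
    have hder : deriv (fun y => u y * f (g y)) =
        fun y => deriv u y * f (g y) + u y * deriv g y * deriv f (g y) := by
      funext y
      have hu' := (hu.differentiable (by simp) y).hasDerivAt
      have hg' := (hg.differentiable (by simp) y).hasDerivAt
      have hf' := (hf.differentiable (by simp) (g y)).hasDerivAt
      refine (hu'.mul (hf'.comp y hg')).deriv.trans ?_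
      simp only [Function.comp]
      ring
    have hn : ((n : ℕ∞) : WithTop ℕ∞) ≤ (⊤ : ℕ∞) := by exact_mod_cast le_top
    rw [iteratedDeriv_succ', hder, iteratedDeriv_fun_add
      (f := fun y => deriv u y * f (g y))
      (g := fun y => u y * deriv g y * deriv f (g y))
      (((hd hu).mul (hf.comp hg)).of_le hn).contDiffAt
      (((hu.mul (hd hg)).mul ((hd hf).comp hg)).of_le hn).contDiffAt,
      ih hf (hd hu) fun j hj => h j (by omega),
      ih (hd hf) (hu.mul (hd hg)) fun j hj => by
        rw [← iteratedDeriv_succ']; exact h (j + 1) (by omega),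
      add_zero]

theorem iteratedDeriv_comp_eq_zero {f g : ℝ → ℝ} (hf : ContDiff ℝ (⊤ : ℕ∞) f)
    (hg : ContDiff ℝ (⊤ : ℕ∞) g) {x : ℝ} {n : ℕ} (h : ∀ j ≤ n, iteratedDeriv j f (g x) = 0) :
    iteratedDeriv n (fun y => f (g y)) x = 0 := by
  simpa using iteratedDeriv_mul_comp_eq_zero hg x n hf (u := fun _ => 1) contDiff_const h

/-! ### One-sided interpolation of `cos √y` -/

section CosSqrtInterpolation

open Polynomial

variable {s : Multiset ℝ} {q : ℝ[X]}

/-- The 17th derivative of the node polynomial is affine and vanishes at the mean of the nodes,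
while that of `q` is constant. -/
theorem iteratedDeriv_cosSqrt_sub (hcard : s.card = 18) (hq : q.degree < (18 : ℕ)) (l z : ℝ) :
    iteratedDeriv 17 (fun y => cosSqrt 0 y - (q + C l * nodePoly s).eval y) z =
      -cosSqrt 17 z - Nat.factorial 17 * q.coeff 17 - l * Nat.factorial 18 * (z - s.sum / 18) := by
  rw [iteratedDeriv_sub_polynomial (contDiff_cosSqrt 0), iteratedDeriv_cosSqrt, iterate_map_add,
    iterate_derivative_C_mul, eval_add, eval_mul, eval_C, nodePoly_iterate_derivative s hcard,
    iterate_derivative_of_degree_lt hq]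
  rw [Nat.factorial_succ 17]
  push_cast
  norm_num
  ring

theorem vanishesOn_cosSqrt_sub (hv : VanishesOn (fun y => cosSqrt 0 y - q.eval y) s) (l : ℝ) :
    VanishesOn (fun y => cosSqrt 0 y - (q + C l * nodePoly s).eval y) s := by
  intro x j hj
  have hx := hv x j hj
  rw [iteratedDeriv_sub_polynomial (contDiff_cosSqrt 0)] at hx ⊢
  rw [iterate_map_add, iterate_derivative_C_mul, eval_add, eval_mul, eval_C,
    nodePoly_derivative_eval s hj]
  linarith

theorem contDiff_cosSqrt_sub (p : ℝ[X]) :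
    ContDiff ℝ (⊤ : ℕ∞) fun y => cosSqrt 0 y - p.eval y :=
  (contDiff_cosSqrt 0).sub (contDiff_polynomial_eval p)

/-- The multiple of the node polynomial is chosen so that the zero of the 17th derivative equates
`-17! q₁₇` with `cosSqrt 17 η` minus the linear part of its tangent at the mean of the nodes. By
convexity this is at least the value of `cosSqrt 17` at the mean, which is at most 195. -/
theorem cosSqrt_le_leading_coeff (hcard : s.card = 18) (hs : ∀ x ∈ s, x ∈ Set.Icc (0 : ℝ) 460)
    (hsum : s.sum / 18 ≤ 195) (hq : q.degree < (18 : ℕ))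
    (hv : VanishesOn (fun y => cosSqrt 0 y - q.eval y) s) :
    cosSqrt 17 195 ≤ -(Nat.factorial 17 * q.coeff 17) := by
  have h0 : 0 ≤ s.sum / 18 := div_nonneg (Multiset.sum_nonneg fun x hx => (hs x hx).1) (by norm_num)
  have hm : s.sum / 18 ∈ Set.Icc (0 : ℝ) 460 := ⟨h0, hsum.trans (by norm_num)⟩
  obtain ⟨η, hη, he⟩ := (vanishesOn_cosSqrt_sub hv
    (cosSqrt 18 (s.sum / 18) / Nat.factorial 18)).exists_iteratedDeriv_eq_zero
    (contDiff_cosSqrt_sub _) Set.ordConnected_Icc hs (m := 17) hcard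
  rw [iteratedDeriv_cosSqrt_sub hcard hq, div_mul_cancel₀ _ (by positivity)] at he
  have h1 := cosSqrt_seventeen_tangent hη hm
  have h2 := strictAntiOn_cosSqrt_seventeen.antitoneOn hm (by norm_num) hsum
  generalize (Nat.factorial 17 : ℝ) * q.coeff 17 = c at he ⊢
  linarith

/-- The interpolating polynomial lies strictly below `y ↦ cos √y` off the nodes, if all nodes have
even multiplicity and are not too large. -/
theorem eval_lt_cosSqrt (hcard : s.card = 18) (hs : ∀ x ∈ s, x ∈ Set.Icc (0 : ℝ) 460)
    (hsum : s.sum / 18 ≤ 195) (heven : ∀ y, 0 ≤ (nodePoly s).eval y) (hq : q.degree < (18 : ℕ))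
    (hv : VanishesOn (fun y => cosSqrt 0 y - q.eval y) s) {y : ℝ} (hy : 0 ≤ y) (hys : y ∉ s) :
    q.eval y < cosSqrt 0 y := by
  have hc := cosSqrt_le_leading_coeff hcard hs hsum hq hv
  have hW : 0 < (nodePoly s).eval y := by
    refine (heven y).lt_of_ne' fun h => hys ?_
    have h1 := rootMultiplicity_nodePoly s y
    have h2 := (rootMultiplicity_pos (nodePoly_monic s).ne_zero).2 h
    rw [h1] at h2
    exact Multiset.count_pos.1 h2
  by_contra! hle
  -- This `l` adds `y` to the 18 zeros at the nodes.
  set l := (cosSqrt 0 y - q.eval y) / (nodePoly s).eval y with hl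
  have hl0 : l ≤ 0 := div_nonpos_of_nonpos_of_nonneg (by linarith) hW.le
  have hF := iteratedDeriv_cosSqrt_sub hcard hq l
  have hv' : VanishesOn (fun z => cosSqrt 0 z - (q + C l * nodePoly s).eval z) (y ::ₘ s) := by
    intro x j hj
    by_cases hxy : x = y
    · subst hxy
      rw [Multiset.count_cons_self, Multiset.count_eq_zero.2 hys] at hj
      have : j = 0 := by omega
      subst this
      rw [iteratedDeriv_zero, eval_add, eval_mul, eval_C, hl, div_mul_cancel₀ _ hW.ne']
      ring
    · rw [Multiset.count_cons_of_ne hxy] at hj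
      exact vanishesOn_cosSqrt_sub hv l x j hj
  obtain ⟨a, ha, b, hb, ha0, hb0, hab⟩ := hv'.exists_iteratedDeriv_two (contDiff_cosSqrt_sub _)
    Set.ordConnected_Ici (I := Set.Ici 0)
    (fun x hx => by
      rcases Multiset.mem_cons.1 hx with rfl | hx
      · exact hy
      · exact (hs x hx).1)
    (m := 17) (by rw [Multiset.card_cons, hcard])
  have hK : (0 : ℝ) < Nat.factorial 18 := by positivity
  generalize (Nat.factorial 17 : ℝ) * q.coeff 17 = c at hF hc
  generalize (Nat.factorial 18 : ℝ) = K at hF hK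
  -- Beyond 460 the 17th derivative is positive: the leading coefficient outweighs `cosSqrt 17`, and
  -- the affine term has the helpful sign because `l ≤ 0` and `z` exceeds the mean of the nodes.
  have hle460 : ∀ z, 0 ≤ z → iteratedDeriv 17
      (fun z => cosSqrt 0 z - (q + C l * nodePoly s).eval z) z = 0 → z ≤ 460 := by
    intro z hz hz0
    by_contra! hlt
    have h1 := (abs_lt.1 (abs_cosSqrt_seventeen_lt hlt.le)).2
    rw [hF] at hz0
    have h2 : l * K * (z - s.sum / 18) ≤ 0 :=
      mul_nonpos_of_nonpos_of_nonneg (mul_nonpos_of_nonpos_of_nonneg hl0 hK.le) (by linarith)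
    linarith
  have ha' : a ∈ Set.Icc (0 : ℝ) 460 := ⟨ha, hle460 a ha ha0⟩
  have hb' : b ∈ Set.Icc (0 : ℝ) 460 := ⟨hb, hle460 b hb hb0⟩
  -- On `[0, 460]` the 17th derivative is strictly increasing with positive slope, which excludes
  -- both two distinct zeros and a double zero.
  rcases hab with hab | hab
  · rw [hF] at ha0 hb0
    have h1 := strictAntiOn_cosSqrt_seventeen ha' hb' hab
    have h2 : l * K * (b - a) ≤ 0 :=
      mul_nonpos_of_nonpos_of_nonneg (mul_nonpos_of_nonpos_of_nonneg hl0 hK.le) (by linarith)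
    linarith
  · rw [funext hF] at hab
    have hd : HasDerivAt (fun z => -cosSqrt 17 z - c -
        l * K * (z - s.sum / 18)) (-(-cosSqrt 18 a) - l * K * 1) a :=
      ((hasDerivAt_cosSqrt 17 a).neg.sub_const _).sub
        (((hasDerivAt_id a).sub_const _).const_mul _)
    rw [hd.deriv] at hab
    have h1 := cosSqrt_eighteen_pos ha'
    have h2 : l * K ≤ 0 := mul_nonpos_of_nonpos_of_nonneg hl0 hK.le
    linarith

theorem eval_eq_cosSqrt (hv : VanishesOn (fun y => cosSqrt 0 y - q.eval y) s) {y : ℝ}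
    (hys : y ∈ s) : q.eval y = cosSqrt 0 y := by
  have := hv y 0 (Multiset.count_pos.2 hys)
  rw [iteratedDeriv_zero] at this
  linarith

end CosSqrtInterpolation

/-! ### The overlap of the example state -/

open Real

/-- Fifteen times the overlap of the example state with its evolved state. -/
noncomputable def overlapCos (t : ℝ) : ℝ := 7 + 4 * cos t + 4 * cos (11 * t / 5)

theorem sin_le_quintic {x : ℝ} (h0 : 0 ≤ x) (h1 : x ≤ 1) :
    sin x ≤ x - x ^ 3 / 6 + x ^ 5 / 100 := by
  have h := Real.sin_bound (x := x) (by rwa [abs_of_nonneg h0])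
  rw [abs_of_nonneg h0] at h
  linarith [(abs_le.1 h).2]

theorem cos_le_of_half {x : ℝ} (h0 : 0 ≤ x) (h1 : x ≤ 2) :
    cos x ≤ 1 - 2 * (x / 2 - (x / 2) ^ 3 / 6) ^ 2 := by
  have h := sin_ge_sub_cube (x := x / 2) (by positivity)
  have h2 : 0 ≤ x / 2 - (x / 2) ^ 3 / 6 := by
    nlinarith [mul_nonneg h0 h0, mul_nonneg h0 (mul_nonneg h0 h0)]
  have h3 : cos x = 1 - 2 * sin (x / 2) ^ 2 := by
    rw [← cos_sq_add_sin_sq (x / 2), show x = 2 * (x / 2) by ring, cos_two_mul]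
    have := cos_sq_add_sin_sq (x / 2)
    rw [show 2 * (x / 2) / 2 = x / 2 by ring]
    linarith
  rw [h3]
  have := pow_le_pow_left₀ h2 h 2
  linarith

theorem neg_three_quarters_lt_cos {x : ℝ} (hx : |x| ≤ 2.38) : -(3 / 4) < cos x := by
  have hpi := pi_gt_d6
  have hpi' := pi_lt_d6
  have h1 : cos 2.38 ≤ cos |x| :=
    cos_le_cos_of_nonneg_of_le_pi (abs_nonneg x) (by linarith) hx
  rw [cos_abs] at h1
  have h2 : cos 2.38 = -cos (π - 2.38) := by rw [cos_pi_sub, neg_neg]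
  have h3 : cos (π - 2.38) ≤ cos 0.76 :=
    cos_le_cos_of_nonneg_of_le_pi (by norm_num) (by linarith) (by linarith)
  have h4 := cos_le_of_half (x := 0.76) (by norm_num) (by norm_num)
  norm_num at *
  linarith

/-- The overlap can vanish only if both cosines are at most `-3/4`. Four intervals cover `[0, 9.6]`;
on each, `t` or `11t/5` stays within `2.38` of a multiple of `2π`. -/
theorem overlapCos_pos {t : ℝ} (h0 : 0 ≤ t) (h1 : t ≤ 9.6) : 0 < overlapCos t := by
  have hpi := pi_gt_d6
  have hpi' := pi_lt_d6
  have hc : -1 ≤ cos t := neg_one_le_cos t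
  have hc' : -1 ≤ cos (11 * t / 5) := neg_one_le_cos _
  suffices h : -(3 / 4) < cos t ∨ -(3 / 4) < cos (11 * t / 5) by
    unfold overlapCos
    rcases h with h | h <;> linarith
  by_cases ha : t ≤ 2.2
  · exact .inl (neg_three_quarters_lt_cos (abs_le.2 ⟨by linarith, by linarith⟩))
  by_cases hb : t ≤ 3.91
  · right
    rw [← cos_sub_two_pi]
    exact neg_three_quarters_lt_cos (abs_le.2 ⟨by linarith, by linarith⟩)
  by_cases hd : t ≤ 8
  · left
    rw [← cos_sub_two_pi]
    exact neg_three_quarters_lt_cos (abs_le.2 ⟨by linarith, by linarith⟩)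
  · right
    rw [← cos_sub_nat_mul_two_pi _ 3]
    push_cast
    exact neg_three_quarters_lt_cos (abs_le.2 ⟨by linarith, by linarith⟩)

theorem cos_eq_neg_cos_sub_three_pi (t : ℝ) : cos t = -cos (t - 3 * π) := by
  rw [← cos_sub_two_pi t, show t - 3 * π = t - 2 * π - π by ring, cos_sub_pi, neg_neg]

theorem overlapCos_neg : overlapCos 9.74 < 0 := by
  have hpi := pi_gt_d6
  have hpi' := pi_lt_d6
  have h1 := one_sub_sq_div_two_le_cos (x := 9.74 - 3 * π)
  have h2 := one_sub_sq_div_two_le_cos (x := 11 * 9.74 / 5 - 7 * π)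
  rw [show cos (11 * 9.74 / 5 - 7 * π) = -cos (11 * 9.74 / 5) by
    rw [show 11 * 9.74 / 5 - 7 * π = 11 * 9.74 / 5 - (3 : ℕ) * (2 * π) - π by push_cast; ring,
      cos_sub_pi, cos_sub_nat_mul_two_pi]] at h2
  unfold overlapCos
  rw [cos_eq_neg_cos_sub_three_pi 9.74]
  have h3 : (9.74 - 3 * π) ^ 2 ≤ 0.1 := by nlinarith
  have h4 : (11 * 9.74 / 5 - 7 * π) ^ 2 ≤ 0.32 := by nlinarith
  linarith

theorem continuous_overlapCos : Continuous overlapCos := by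
  unfold overlapCos; fun_prop

theorem exists_isLeast_overlapCos_zero :
    ∃ τ, IsLeast {t : ℝ | 0 ≤ t ∧ overlapCos t = 0} τ := by
  have hcl : IsClosed {t : ℝ | 0 ≤ t ∧ overlapCos t = 0} :=
    isClosed_Ici.inter (isClosed_eq continuous_overlapCos continuous_const)
  have hne : {t : ℝ | 0 ≤ t ∧ overlapCos t = 0}.Nonempty := by
    obtain ⟨t, ht, h⟩ := intermediate_value_Icc' (show (9.6 : ℝ) ≤ 9.74 by norm_num)
      continuous_overlapCos.continuousOn
      ⟨overlapCos_neg.le, (overlapCos_pos (by norm_num) le_rfl).le⟩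
    exact ⟨t, by linarith [ht.1], h⟩
  exact ⟨_, hcl.isLeast_csInf hne ⟨0, fun t ht => ht.1⟩⟩

theorem isLeast_overlapCos_bounds {τ : ℝ} (h : IsLeast {t : ℝ | 0 ≤ t ∧ overlapCos t = 0} τ) :
    9.6 < τ ∧ τ ≤ 9.74 := by
  constructor
  · by_contra! hle
    exact (overlapCos_pos h.1.1 hle).ne' h.1.2
  · obtain ⟨t, ht, h0⟩ := intermediate_value_Icc' (show (9.6 : ℝ) ≤ 9.74 by norm_num)
      continuous_overlapCos.continuousOn
      ⟨overlapCos_neg.le, (overlapCos_pos (by norm_num) le_rfl).le⟩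
    exact (h.2 ⟨by linarith [ht.1], h0⟩).trans ht.2

/-- Near `3π` one has `cos t ≤ -0.95`, so the vanishing overlap puts `cos (11t/5)` in `[-0.8,
-0.75]`; the larger cosine belongs to the smaller sine. -/
theorem abs_sin_lt_of_overlapCos_eq_zero {t : ℝ} (h0 : 9.6 < t) (h1 : t ≤ 9.74)
    (h : overlapCos t = 0) : |sin t| < |sin (11 * t / 5)| := by
  have hpi := pi_gt_d6
  have hpi' := pi_lt_d6
  have h2 := one_sub_sq_div_two_le_cos (x := t - 3 * π)
  have h3 : (t - 3 * π) ^ 2 ≤ 0.1 := by nlinarith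
  have h4 := cos_eq_neg_cos_sub_three_pi t
  have h5 := neg_one_le_cos t
  unfold overlapCos at h
  rw [← sq_lt_sq, sin_sq, sin_sq]
  have h6 : cos (11 * t / 5) = -7 / 4 - cos t := by linarith
  rw [h6]
  nlinarith

theorem hasDerivAt_overlapCos (t : ℝ) :
    HasDerivAt overlapCos (-(4 * sin t) - 44 / 5 * sin (11 * t / 5)) t := by
  have h1 : HasDerivAt (fun t : ℝ => 11 * t / 5) (11 / 5) t := by
    simpa using ((hasDerivAt_id t).const_mul 11).div_const 5
  refine ((((hasDerivAt_cos t).const_mul 4).const_add 7).add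
    ((h1.cos).const_mul 4)).congr_deriv ?_
  ring

/-- The derivative changes sign between `4.1095` and `4.1105`. At its zero both cosines are
negative, so the second derivative is positive. The angles are reduced to small ones, where Taylor
bounds are sharp enough. -/
theorem exists_isLocalMin_overlapCos :
    ∃ τ, IsLocalMin overlapCos τ ∧ |τ - 4.110| ≤ 0.0005 := by
  have hpi := pi_gt_d6
  have hpi' := pi_lt_d6
  have hder : deriv overlapCos = fun t => -(4 * sin t) - 44 / 5 * sin (11 * t / 5) :=
    funext fun t => (hasDerivAt_overlapCos t).deriv
  have hs1 : ∀ t, sin t = -cos (3 * π / 2 - t) := fun t => by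
    rw [show 3 * π / 2 - t = π + (π / 2 - t) by ring, cos_add]
    simp [cos_pi_div_two_sub]
  have hs2 : ∀ t, sin t = sin (3 * π - t) := fun t => by
    rw [show 3 * π - t = π - t + 2 * π by ring, sin_add_two_pi, sin_pi_sub]
  have hcont : Continuous (deriv overlapCos) := by rw [hder]; fun_prop
  have ha : deriv overlapCos 4.1095 ≤ 0 := by
    rw [hder]
    simp only
    have h1 : cos (3 * π / 2 - 4.1095) ≤ cos 0.602887 :=
      cos_le_cos_of_nonneg_of_le_pi (by norm_num) (by linarith) (by linarith)
    have h2 := cos_le_of_half (x := 0.602887) (by norm_num) (by norm_num)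
    have h3 := sin_ge_sub_cube (x := 0.383875) (by norm_num)
    have h4 : sin 0.383875 ≤ sin (3 * π - 11 * 4.1095 / 5) :=
      sin_le_sin_of_le_of_le_pi_div_two (by linarith) (by linarith) (by linarith)
    rw [hs1, hs2 (11 * 4.1095 / 5)]
    norm_num at *
    linarith
  have hb : 0 ≤ deriv overlapCos 4.1105 := by
    rw [hder]
    simp only
    have h2 : cos 0.6019 ≤ cos (3 * π / 2 - 4.1105) :=
      cos_le_cos_of_nonneg_of_le_pi (by linarith) (by linarith) (by linarith)
    have h3 : cos 0.6019 = 1 - 2 * sin 0.30095 ^ 2 := by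
      have := cos_sq_add_sin_sq (0.30095 : ℝ)
      rw [show (0.6019 : ℝ) = 2 * 0.30095 by norm_num, cos_two_mul]
      linarith
    have h4 := sin_le_quintic (x := 0.30095) (by norm_num) (by norm_num)
    have h5 : 0 ≤ sin 0.30095 := sin_nonneg_of_nonneg_of_le_pi (by norm_num) (by linarith)
    have h6 := pow_le_pow_left₀ h5 h4 2
    have h7 := sin_le_quintic (x := 0.38168) (by norm_num) (by norm_num)
    have h8 : sin (3 * π - 11 * 4.1105 / 5) ≤ sin 0.38168 :=
      sin_le_sin_of_le_of_le_pi_div_two (by linarith) (by linarith) (by linarith)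
    rw [hs1, hs2 (11 * 4.1105 / 5)]
    norm_num at *
    linarith
  obtain ⟨τ, hτ, h0⟩ := intermediate_value_Icc (show (4.1095 : ℝ) ≤ 4.1105 by norm_num)
    hcont.continuousOn ⟨ha, hb⟩
  refine ⟨τ, ?_, abs_le.2 ⟨by linarith [hτ.1], by linarith [hτ.2]⟩⟩
  refine isLocalMin_of_deriv_deriv_pos ?_ h0 continuous_overlapCos.continuousAt
  have h1 : HasDerivAt (fun t : ℝ => 11 * t / 5) (11 / 5) τ := by
    simpa using ((hasDerivAt_id τ).const_mul 11).div_const 5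
  have h4 : HasDerivAt (fun t => -(4 * sin t) - 44 / 5 * sin (11 * t / 5))
      (-(4 * cos τ) - 44 / 5 * (cos (11 * τ / 5) * (11 / 5))) τ :=
    (((hasDerivAt_sin τ).const_mul 4).neg).sub ((h1.sin).const_mul (44 / 5))
  rw [hder, h4.deriv]
  have h2 : cos τ < 0 :=
    cos_neg_of_pi_div_two_lt_of_lt (by linarith [hτ.1]) (by linarith [hτ.2])
  have h3 : cos (11 * τ / 5) < 0 := by
    rw [← cos_sub_two_pi]
    exact cos_neg_of_pi_div_two_lt_of_lt (by linarith [hτ.1]) (by linarith [hτ.2])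
  linarith

/-! ### From the squared variable back to the cosine -/

theorem VanishesOn.replicate_add {f : ℝ → ℝ} {s : Multiset ℝ} {a : ℝ} {n : ℕ}
    (ha : ∀ j < n, iteratedDeriv j f a = 0) (has : a ∉ s) (hs : VanishesOn f s) :
    VanishesOn f (Multiset.replicate n a + s) := by
  intro x j hj
  rw [Multiset.count_add, Multiset.count_replicate] at hj
  split_ifs at hj with h
  · subst h
    rw [Multiset.count_eq_zero.2 has] at hj
    exact ha j (by omega)
  · exact hs x j (by omega)

theorem vanishesOn_zero (f : ℝ → ℝ) : VanishesOn f 0 := fun x j hj => by simp at hj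

theorem VanishesOn.of_replicate {f : ℝ → ℝ} {s : Multiset ℝ} (hs : VanishesOn f s) {a : ℝ} {n : ℕ}
    (h : Multiset.replicate n a ≤ s) : ∀ j < n, iteratedDeriv j f a = 0 :=
  fun j hj => hs a j (hj.trans_le (Multiset.le_count_iff_replicate_le.2 h))

/-- The squares of the interpolation times, with half of the multiplicity at `0` (counted as `4`,
in view of evenness). -/
noncomputable def squareNodes (τ₁ τ₂ : ℝ) : Multiset ℝ :=
  .replicate 2 0 + (.replicate 4 (τ₁ ^ 2) + (.replicate 2 (τ₂ ^ 2) +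
    (.replicate 6 ((11 * τ₁ / 5) ^ 2) + (.replicate 4 ((11 * τ₂ / 5) ^ 2) + 0))))

section Interpolant

open Polynomial

variable {τ₁ τ₂ : ℝ} (h₁ : 9.6 < τ₁) (h₁' : τ₁ ≤ 9.74) (h₂ : |τ₂ - 4.110| ≤ 0.0005)

theorem mem_squareNodes {x : ℝ} : x ∈ squareNodes τ₁ τ₂ ↔
    x = 0 ∨ x = τ₁ ^ 2 ∨ x = τ₂ ^ 2 ∨ x = (11 * τ₁ / 5) ^ 2 ∨ x = (11 * τ₂ / 5) ^ 2 := by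
  simp only [squareNodes, Multiset.mem_add, Multiset.mem_replicate, Multiset.notMem_zero, ne_eq,
    OfNat.ofNat_ne_zero, not_false_eq_true, true_and, or_false]

theorem card_squareNodes : (squareNodes τ₁ τ₂).card = 18 := by
  simp [squareNodes]

theorem nodePoly_squareNodes_nonneg (y : ℝ) : 0 ≤ (nodePoly (squareNodes τ₁ τ₂)).eval y := by
  simp only [nodePoly, squareNodes, Multiset.map_add, Multiset.map_replicate, Multiset.prod_add,
    Multiset.prod_replicate, eval_mul, eval_pow, eval_sub, eval_X, eval_C, Multiset.map_zero,
    Multiset.prod_zero, eval_one]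
  have h4 (z : ℝ) : 0 ≤ z ^ 4 := Even.pow_nonneg (by decide) z
  have h6 (z : ℝ) : 0 ≤ z ^ 6 := Even.pow_nonneg (by decide) z
  have h2 (z : ℝ) : 0 ≤ z ^ 2 := sq_nonneg z
  exact mul_nonneg (h2 _) (mul_nonneg (h4 _) (mul_nonneg (h2 _) (mul_nonneg (h6 _)
    (mul_nonneg (h4 _) zero_le_one))))

include h₁ h₁' h₂ in
theorem squareNodes_mem_Icc : ∀ x ∈ squareNodes τ₁ τ₂, x ∈ Set.Icc (0 : ℝ) 460 := by
  have hb := abs_le.1 h₂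
  intro x hx
  rcases mem_squareNodes.1 hx with rfl | rfl | rfl | rfl | rfl
  · norm_num
  all_goals exact ⟨sq_nonneg _, by nlinarith⟩

include h₁ h₁' h₂ in
theorem sum_squareNodes_le : (squareNodes τ₁ τ₂).sum / 18 ≤ 195 := by
  have hb := abs_le.1 h₂
  simp only [squareNodes, Multiset.sum_add, Multiset.sum_replicate, Multiset.sum_zero, nsmul_eq_mul]
  push_cast
  have e1 : τ₁ ^ 2 ≤ 95 := by nlinarith
  have e2 : τ₂ ^ 2 ≤ 16.9 := by nlinarith
  nlinarith

theorem eval_expand_two (q : ℝ[X]) (x : ℝ) :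
    Real.cos x - (expand ℝ 2 q).eval x = cosSqrt 0 (x ^ 2) - q.eval (x ^ 2) := by
  rw [cosSqrt_zero_sq, expand_eval]

theorem matchesCos_iff (p : ℝ[X]) (m : ℕ) (x : ℝ) :
    QSL.MatchesCos p m x ↔ ∀ j < m, iteratedDeriv j (fun x => Real.cos x - p.eval x) x = 0 := by
  refine forall₂_congr fun j _ => ?_
  rw [iteratedDeriv_sub_polynomial Real.contDiff_cos, sub_eq_zero, eq_comm]

theorem matchesCos_expand {q : ℝ[X]} {m : ℕ} {x : ℝ}
    (h : ∀ j < m, iteratedDeriv j (fun y => cosSqrt 0 y - q.eval y) (x ^ 2) = 0) :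
    QSL.MatchesCos (expand ℝ 2 q) m x := by
  rw [matchesCos_iff]
  intro j hj
  simp only [eval_expand_two]
  exact iteratedDeriv_comp_eq_zero (g := fun x => x ^ 2) (contDiff_cosSqrt_sub q)
    (contDiff_id.pow 2) fun i hi => h i (by omega)

/-- A double zero in `y = x²` is a zero of order four in `x`, of which three orders are needed: the
second derivative of `D(x²)` at `0` is `2 D'(0)`. -/
theorem matchesCos_expand_zero {q : ℝ[X]}
    (h : ∀ j < 2, iteratedDeriv j (fun y => cosSqrt 0 y - q.eval y) 0 = 0) :
    QSL.MatchesCos (expand ℝ 2 q) 3 0 := by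
  have h2 : QSL.MatchesCos (expand ℝ 2 q) 2 0 := matchesCos_expand (by simpa using h)
  rw [matchesCos_iff] at h2 ⊢
  intro j hj
  rcases (by omega : j < 2 ∨ j = 2) with hj | rfl
  · exact h2 j hj
  simp only [eval_expand_two]
  set D : ℝ → ℝ := fun y => cosSqrt 0 y - q.eval y with hD
  have hsm : ContDiff ℝ (⊤ : ℕ∞) D := contDiff_cosSqrt_sub q
  have hdsm : ContDiff ℝ (⊤ : ℕ∞) (deriv D) := (contDiff_infty_iff_deriv.1 hsm).2
  have hsq (x : ℝ) : HasDerivAt (fun x : ℝ => x ^ 2) (2 * x) x := by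
    simpa using hasDerivAt_pow 2 x
  have hd (x : ℝ) : HasDerivAt (fun x => D (x ^ 2)) (deriv D (x ^ 2) * (2 * x)) x := by
    have h := (hsm.differentiable (by simp) (x ^ 2)).hasDerivAt.comp (h := fun x => x ^ 2) x (hsq x)
    exact h
  have hd2 : HasDerivAt (fun x => deriv D (x ^ 2) * (2 * x))
      (deriv (deriv D) (0 ^ 2) * (2 * 0) * (2 * 0) + deriv D (0 ^ 2) * (2 * 1)) 0 := by
    have h := ((hdsm.differentiable (by simp) (0 ^ 2)).hasDerivAt.comp (h := fun x => x ^ 2)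
      0 (hsq 0)).mul ((hasDerivAt_id 0).const_mul 2)
    exact h
  change iteratedDeriv 2 (fun x => D (x ^ 2)) 0 = 0
  rw [iteratedDeriv_succ', iteratedDeriv_one, funext fun x => (hd x).deriv, hd2.deriv]
  have h1 := h 1 (by norm_num)
  rw [iteratedDeriv_one] at h1
  simp [h1]

/-- The Hermite interpolant in the squared variable. -/
theorem exists_squareNodes_interpolant (τ₁ τ₂ : ℝ) : ∃ q : ℝ[X], q.degree < (18 : ℕ) ∧
    VanishesOn (fun y => cosSqrt 0 y - q.eval y) (squareNodes τ₁ τ₂) := by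
  have := exists_hermite_interpolant (contDiff_cosSqrt 0) (squareNodes τ₁ τ₂)
  rwa [card_squareNodes] at this

theorem isHermiteInterpolant_expand {q : ℝ[X]} (hq : q.degree < (18 : ℕ))
    (hv : VanishesOn (fun y => cosSqrt 0 y - q.eval y) (squareNodes τ₁ τ₂)) :
    QSL.IsHermiteInterpolant τ₁ τ₂ (expand ℝ 2 q) := by
  have hz := hv.of_replicate (Multiset.le_add_right _ _)
  have hle {a b c : Multiset ℝ} (h : a ≤ c) : a ≤ b + c := h.trans (Multiset.le_add_left _ _)
  have h1 := hv.of_replicate (hle (Multiset.le_add_right _ _))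
  have h2 := hv.of_replicate (hle (hle (Multiset.le_add_right _ _)))
  have h3 := hv.of_replicate (hle (hle (hle (Multiset.le_add_right _ _))))
  have h4 := hv.of_replicate (hle (hle (hle (hle (Multiset.le_add_right _ _)))))
  refine ⟨?_, matchesCos_expand_zero hz, ⟨matchesCos_expand h1, matchesCos_expand ?_⟩,
    ⟨matchesCos_expand h2, matchesCos_expand ?_⟩, ⟨matchesCos_expand h3, matchesCos_expand ?_⟩,
    ⟨matchesCos_expand h4, matchesCos_expand ?_⟩⟩
  · have : q.natDegree ≤ 17 := natDegree_le_iff_coeff_eq_zero.2 fun k hk =>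
      (degree_lt_iff_coeff_zero q 18).1 hq k hk
    rw [natDegree_expand]
    omega
  all_goals rwa [neg_sq]

include h₁ h₁' h₂ in
-- The 35 conditions sit at distinct points by the numerical bounds on `τ₁` and `τ₂`, so a
-- difference of degree at most 34 has too many zeros. This is what makes every interpolant even.
theorem isHermiteInterpolant_unique {p p' : ℝ[X]} (hp : QSL.IsHermiteInterpolant τ₁ τ₂ p)
    (hp' : QSL.IsHermiteInterpolant τ₁ τ₂ p') : p = p' := by
  have hb := abs_le.1 h₂
  have hm {m : ℕ} {x : ℝ} (h : QSL.MatchesCos p m x) (h' : QSL.MatchesCos p' m x) :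
      ∀ j < m, iteratedDeriv j (fun x => (p - p').eval x) x = 0 := fun j hj => by
    
    rw [iteratedDeriv_polynomial_eval]
    simp only [iterate_derivative_sub, eval_sub, h j hj, h' j hj, sub_self]
  have key : VanishesOn (fun x => (p - p').eval x)
      (.replicate 3 0 + (.replicate 4 τ₁ + (.replicate 4 (-τ₁) + (.replicate 2 τ₂ +
        (.replicate 2 (-τ₂) + (.replicate 6 (11 * τ₁ / 5) + (.replicate 6 (-(11 * τ₁ / 5)) +
        (.replicate 4 (11 * τ₂ / 5) + (.replicate 4 (-(11 * τ₂ / 5)) + 0))))))))) := by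
    refine .replicate_add (hm hp.at_zero hp'.at_zero) ?_ <|
      .replicate_add (hm hp.at_first.1 hp'.at_first.1) ?_ <|
      .replicate_add (hm hp.at_first.2 hp'.at_first.2) ?_ <|
      .replicate_add (hm hp.at_second.1 hp'.at_second.1) ?_ <|
      .replicate_add (hm hp.at_second.2 hp'.at_second.2) ?_ <|
      .replicate_add (hm hp.at_scaled_first.1 hp'.at_scaled_first.1) ?_ <|
      .replicate_add (hm hp.at_scaled_first.2 hp'.at_scaled_first.2) ?_ <|
      .replicate_add (hm hp.at_scaled_second.1 hp'.at_scaled_second.1) ?_ <|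
      .replicate_add (hm hp.at_scaled_second.2 hp'.at_scaled_second.2) ?_ <| vanishesOn_zero _
    all_goals
      intro h
      simp only [Multiset.mem_add, Multiset.mem_replicate, Multiset.notMem_zero, or_false] at h
    all_goals
      repeat' rcases h with h | h
      all_goals linarith [h.2]
  have h0 := polynomial_eq_zero_of_vanishesOn key (by
    have h3 := natDegree_sub_le_of_le hp.natDegree_le hp'.natDegree_le
    simp only [Multiset.card_add, Multiset.card_replicate, Multiset.card_zero]
    omega)
  exact sub_eq_zero.1 h0

include h₁ h₁' h₂ in
/-- The interpolating polynomial is an even lower bound of the cosine, and it touches the cosine at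
the interpolation points only. -/
theorem isHermiteInterpolant_le_cos {p : ℝ[X]} (hp : QSL.IsHermiteInterpolant τ₁ τ₂ p) :
    (∃ q : ℝ[X], q.natDegree < 18 ∧ p = expand ℝ 2 q) ∧
      (∀ x, p.eval x ≤ Real.cos x) ∧
      ∀ x, p.eval x = Real.cos x ↔ x ^ 2 ∈ squareNodes τ₁ τ₂ := by
  obtain ⟨q, hq, hv⟩ := exists_squareNodes_interpolant τ₁ τ₂
  obtain rfl := isHermiteInterpolant_unique h₁ h₁' h₂ hp (isHermiteInterpolant_expand hq hv)
  have hlt {y : ℝ} (hy : 0 ≤ y) (hys : y ∉ squareNodes τ₁ τ₂) : q.eval y < cosSqrt 0 y :=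
    eval_lt_cosSqrt card_squareNodes (squareNodes_mem_Icc h₁ h₁' h₂)
      (sum_squareNodes_le h₁ h₁' h₂) nodePoly_squareNodes_nonneg hq hv hy hys
  have heq {y : ℝ} (hys : y ∈ squareNodes τ₁ τ₂) : q.eval y = cosSqrt 0 y :=
    eval_eq_cosSqrt hv hys
  refine ⟨⟨q, ?_, rfl⟩, fun x => ?_, fun x => ⟨fun h => ?_, fun h => ?_⟩⟩
  · by_cases h0 : q = 0
    · simp [h0]
    · exact (natDegree_lt_iff_degree_lt h0).2 hq
  · rw [expand_eval, ← cosSqrt_zero_sq]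
    by_cases h : x ^ 2 ∈ squareNodes τ₁ τ₂
    · exact (heq h).le
    · exact (hlt (sq_nonneg x) h).le
  · rw [expand_eval, ← cosSqrt_zero_sq] at h
    by_contra hn
    exact (hlt (sq_nonneg x) hn).ne h
  · rw [expand_eval, ← cosSqrt_zero_sq]
    exact heq h

end Interpolant

/-! ### Decomposition of a state by energy -/

namespace QSL

namespace Hamiltonian

variable {ι : Type*} {𝓗 : Type*} [NormedAddCommGroup 𝓗] [InnerProductSpace ℂ 𝓗]
  (H : Hamiltonian ι 𝓗)

theorem amplitude_ext {x y : 𝓗} (h : ∀ j, H.amplitude x j = H.amplitude y j) : x = y := by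
  refine H.basis.repr.injective (lp.ext (funext fun j => ?_))
  rw [HilbertBasis.repr_apply_apply, HilbertBasis.repr_apply_apply]
  exact h j

theorem amplitude_smul (c : ℂ) (x : 𝓗) (j : ι) :
    H.amplitude (c • x) j = c * H.amplitude x j :=
  inner_smul_right _ _ _

theorem amplitude_sum {κ : Type*} (s : Finset κ) (x : κ → 𝓗) (j : ι) :
    H.amplitude (∑ k ∈ s, x k) j = ∑ k ∈ s, H.amplitude (x k) j :=
  inner_sum _ _ _

theorem hasSum_amplitude (x : 𝓗) : HasSum (fun j => H.amplitude x j • H.basis j) x := by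
  simpa only [amplitude, HilbertBasis.repr_apply_apply] using H.basis.hasSum_repr x

theorem amplitude_of_hasSum {c : ι → ℂ} {x : 𝓗} (h : HasSum (fun j => c j • H.basis j) x) (i : ι) :
    H.amplitude x i = c i := by
  classical
  have h1 := h.mapL (innerSL ℂ (H.basis i))
  have h2 : (fun j => innerSL ℂ (H.basis i) (c j • H.basis j)) = fun j => if j = i then c i else 0 := by
    funext j
    rw [innerSL_apply_apply, inner_smul_right, orthonormal_iff_ite.1 H.basis.orthonormal i j]
    by_cases hij : j = i
    · subst hij; simp
    · simp [hij, Ne.symm hij]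
  rw [h2] at h1
  exact h1.unique (hasSum_ite_eq i (c i))

theorem amplitude_evolve (ħ : ℝ) (ψ : 𝓗) (t : ℝ) (j : ι) :
    H.amplitude (H.evolve ħ ψ t) j =
      Complex.exp (-Complex.I * ((H.energy j * t / ħ : ℝ) : ℂ)) * H.amplitude ψ j :=
  H.amplitude_of_hasSum (H.hasSum_evolve ħ ψ t) j

theorem hasSum_inner (x y : 𝓗) :
    HasSum (fun j => starRingEnd ℂ (H.amplitude x j) * H.amplitude y j) ⟪x, y⟫_ℂ := by
  simpa only [amplitude, inner_conj_symm] using H.basis.hasSum_inner_mul_inner x y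

theorem hasSum_norm_sq (x : 𝓗) : HasSum (fun j => ‖H.amplitude x j‖ ^ 2) (‖x‖ ^ 2) := by
  have h := H.hasSum_inner x x
  simp only [Complex.conj_mul'] at h
  rw [inner_self_eq_norm_sq_to_K] at h
  exact Complex.hasSum_ofReal.1 (by push_cast; exact h)

theorem hasSum_overlap (ħ : ℝ) (ψ : 𝓗) (t : ℝ) :
    HasSum (fun j => ‖H.amplitude ψ j‖ ^ 2 •
      Complex.exp (-Complex.I * ((H.energy j * t / ħ : ℝ) : ℂ))) ⟪ψ, H.evolve ħ ψ t⟫_ℂ := by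
  refine (H.hasSum_inner ψ (H.evolve ħ ψ t)).congr_fun fun j => ?_
  rw [amplitude_evolve, mul_left_comm, Complex.conj_mul', Complex.real_smul, mul_comm]
  push_cast
  rfl

open Classical in
/-- The component of a state of the energy `e`. -/
noncomputable def energyPart (ψ : 𝓗) (e : ℝ) : 𝓗 :=
  H.basis.repr.symm ⟨fun j => if H.energy j = e then H.amplitude ψ j else 0, by
    have h0 : Memℓp (fun j => H.amplitude ψ j) 2 := by
      simpa only [amplitude, ← HilbertBasis.repr_apply_apply] using lp.memℓp (H.basis.repr ψ)
    refine Memℓp.mono' h0 fun j => ?_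
    split_ifs <;> simp⟩

open Classical in
theorem amplitude_energyPart (ψ : 𝓗) (e : ℝ) (j : ι) :
    H.amplitude (H.energyPart ψ e) j = if H.energy j = e then H.amplitude ψ j else 0 := by
  rw [amplitude, ← HilbertBasis.repr_apply_apply, energyPart, LinearIsometryEquiv.apply_symm_apply]

theorem isEigenket_smul_energyPart {ψ : 𝓗} {e : ℝ} (h : H.energyPart ψ e ≠ 0) :
    H.IsEigenket e (((‖H.energyPart ψ e‖ : ℂ)⁻¹) • H.energyPart ψ e) := by
  have hn : ‖H.energyPart ψ e‖ ≠ 0 := norm_ne_zero_iff.2 h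
  refine ⟨?_, ?_⟩
  · rw [norm_smul, norm_inv, Complex.norm_real, norm_norm, inv_mul_cancel₀ hn]
  · set v := ((‖H.energyPart ψ e‖ : ℂ)⁻¹) • H.energyPart ψ e with hv
    refine ((H.hasSum_amplitude v).const_smul (e : ℂ)).congr_fun fun j => ?_
    rw [hv, amplitude_smul, amplitude_energyPart, smul_smul]
    split_ifs with hj
    · rw [hj]
    · simp

theorem inner_energyPart_eq_zero (ψ : 𝓗) {e e' : ℝ} (h : e ≠ e') :
    ⟪H.energyPart ψ e, H.energyPart ψ e'⟫_ℂ = 0 := by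
  refine (H.hasSum_inner _ _).unique ((hasSum_zero).congr_fun fun j => ?_)
  rw [amplitude_energyPart, amplitude_energyPart]
  split_ifs with h1 h2
  · exact absurd (h1.symm.trans h2) h
  all_goals simp

/-- The state `ψ` is supported on the energies `e k`, which are distinct. -/
structure SupportedOn {κ : Type*} (ψ : 𝓗) (e : κ → ℝ) : Prop where
  injective : Function.Injective e
  exists_eq : ∀ j, H.amplitude ψ j ≠ 0 → ∃ k, H.energy j = e k

variable {H} {κ : Type*} [Fintype κ] {ψ : 𝓗} {e : κ → ℝ}

theorem SupportedOn.hasSum (h : H.SupportedOn ψ e) {F : Type*} [NormedAddCommGroup F]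
    [NormedSpace ℝ F] (f : ℝ → F) :
    HasSum (fun j => ‖H.amplitude ψ j‖ ^ 2 • f (H.energy j))
      (∑ k, ‖H.energyPart ψ (e k)‖ ^ 2 • f (e k)) := by
  refine (hasSum_sum fun k _ =>
    (H.hasSum_norm_sq (H.energyPart ψ (e k))).smul_const (f (e k))).congr_fun fun j => ?_
  simp only [amplitude_energyPart]
  by_cases hj : H.amplitude ψ j = 0
  · simp [hj]
  · obtain ⟨k, hk⟩ := h.exists_eq j hj
    rw [Finset.sum_eq_single k, if_pos hk, hk]
    · intro l _ hl
      rw [if_neg fun hjl => hl (h.injective (hjl.symm.trans hk))]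
      simp
    · simp

theorem SupportedOn.evolve_eq (h : H.SupportedOn ψ e) (ħ t : ℝ) :
    H.evolve ħ ψ t =
      ∑ k, Complex.exp (-Complex.I * ((e k * t / ħ : ℝ) : ℂ)) • H.energyPart ψ (e k) := by
  refine H.amplitude_ext fun j => ?_
  rw [amplitude_evolve, amplitude_sum]
  simp only [amplitude_smul, amplitude_energyPart]
  by_cases hj : H.amplitude ψ j = 0
  · simp [hj]
  · obtain ⟨k, hk⟩ := h.exists_eq j hj
    rw [Finset.sum_eq_single k, if_pos hk, hk]
    · intro l _ hl
      rw [if_neg fun hjl => hl (h.injective (hjl.symm.trans hk)), mul_zero]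
    · simp

theorem SupportedOn.eq_sum (h : H.SupportedOn ψ e) : ψ = ∑ k, H.energyPart ψ (e k) := by
  refine H.amplitude_ext fun j => ?_
  rw [amplitude_sum]
  simp only [amplitude_energyPart]
  by_cases hj : H.amplitude ψ j = 0
  · simp [hj]
  · obtain ⟨k, hk⟩ := h.exists_eq j hj
    rw [Finset.sum_eq_single k, if_pos hk]
    · intro l _ hl
      rw [if_neg fun hjl => hl (h.injective (hjl.symm.trans hk))]
    · simp

open Classical in
/-- The dimension of the orbit is at least the number of energies that occur in the state, if at
some time the phases of the energies are distinct. -/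
theorem SupportedOn.card_le_orbitDim (h : H.SupportedOn ψ e) {ħ t : ℝ}
    (ht : Function.Injective fun k => Complex.exp (-Complex.I * ((e k * t / ħ : ℝ) : ℂ))) :
    Fintype.card {k // H.energyPart ψ (e k) ≠ 0} ≤ H.orbitDim ħ ψ := by
  set z : κ → ℂ := fun k => Complex.exp (-Complex.I * ((e k * t / ħ : ℝ) : ℂ)) with hz
  set U := Submodule.span ℂ (Set.range fun t : ℝ => H.evolve ħ ψ t) with hU
  have hle : U ≤ Submodule.span ℂ (Set.range fun k => H.energyPart ψ (e k)) := by
    refine Submodule.span_le.2 ?_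
    rintro _ ⟨s, rfl⟩
    simp only
    rw [h.evolve_eq]
    exact Submodule.sum_mem _ fun k _ => Submodule.smul_mem _ _ (Submodule.subset_span ⟨k, rfl⟩)
  have hfin : FiniteDimensional ℂ (Submodule.span ℂ (Set.range fun k => H.energyPart ψ (e k))) :=
    FiniteDimensional.span_of_finite ℂ (Set.finite_range _)
  have hfinU : FiniteDimensional ℂ U := Submodule.finiteDimensional_of_le hle
  -- The evolved state at time `m t` has the `m`-th powers of the phases as coefficients; Lagrange
  -- polynomials in the distinct phases then isolate each component.
  have hpow (m : ℕ) : ∑ k, z k ^ m • H.energyPart ψ (e k) ∈ U := by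
    refine Submodule.subset_span ⟨m * t, ?_⟩
    simp only
    rw [h.evolve_eq]
    refine Finset.sum_congr rfl fun k _ => ?_
    rw [hz, ← Complex.exp_nat_mul]
    congr 2
    push_cast
    ring
  have hmem (k : κ) : H.energyPart ψ (e k) ∈ U := by
    have hL (l : κ) : (Lagrange.basis Finset.univ z k).eval (z l) = if l = k then 1 else 0 := by
      split_ifs with hlk
      · subst hlk
        exact Lagrange.eval_basis_self ht.injOn (Finset.mem_univ _)
      · exact Lagrange.eval_basis_of_ne (Ne.symm hlk) (Finset.mem_univ _)
    have hsum : ∑ l, (Lagrange.basis Finset.univ z k).eval (z l) • H.energyPart ψ (e l) =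
        H.energyPart ψ (e k) := by
      simp [hL]
    rw [← hsum]
    simp only [Polynomial.eval_eq_sum_range, Finset.sum_smul, mul_smul]
    rw [Finset.sum_comm]
    refine Submodule.sum_mem _ fun m _ => ?_
    rw [← Finset.smul_sum]
    exact Submodule.smul_mem _ _ (hpow m)
  have hli : LinearIndependent ℂ fun k : {k // H.energyPart ψ (e k) ≠ 0} =>
      H.energyPart ψ (e k) :=
    linearIndependent_of_ne_zero_of_inner_eq_zero (fun k => k.2) fun k l hkl =>
      H.inner_energyPart_eq_zero ψ fun hkl' => hkl (Subtype.ext (h.injective hkl'))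
  have hliU : LinearIndependent ℂ fun k : {k // H.energyPart ψ (e k) ≠ 0} =>
      (⟨H.energyPart ψ (e k), hmem k⟩ : U) :=
    LinearIndependent.of_comp U.subtype hli
  exact hliU.fintype_card_le_finrank

end Hamiltonian

end QSL

/-! ### The five-level example -/

namespace QSL

open Polynomial

theorem levels_sq (E : ℝ) (k : Fin 5) :
    levels E k ^ 2 = ![0, E ^ 2, E ^ 2, (11 * E / 5) ^ 2, (11 * E / 5) ^ 2] k := by
  fin_cases k <;> simp [levels]

theorem levels_injective {E : ℝ} (hE : 0 < E) : Function.Injective (levels E) := by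
  intro j k h
  fin_cases j <;> fin_cases k <;> first | rfl | (simp [levels] at h; linarith)

theorem levels_mul_div {ħ : ℝ} (hħ : 0 < ħ) (t : ℝ) (k : Fin 5) :
    levels ħ k * t / ħ = levels t k := by
  fin_cases k <;> simp [levels] <;> field_simp

/-- A sum of phases, weighted with the occupations of the levels. -/
theorem sum_levels_exp (w : Fin 5 → ℝ) (t : ℝ) :
    ∑ k, w k • Complex.exp (-Complex.I * ((levels t k : ℝ) : ℂ)) =
      ((w 0 + (w 1 + w 2) * Real.cos t + (w 3 + w 4) * Real.cos (11 * t / 5) : ℝ) : ℂ) -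
      Complex.I * ((((w 1 - w 2) * Real.sin t + (w 3 - w 4) * Real.sin (11 * t / 5) : ℝ)) : ℂ) := by
  have h (x : ℝ) : Complex.exp (-Complex.I * (x : ℂ)) =
      ((Real.cos x : ℝ) : ℂ) - Complex.I * ((Real.sin x : ℝ) : ℂ) := by
    rw [show -Complex.I * (x : ℂ) = ((-x : ℝ) : ℂ) * Complex.I by push_cast; ring,
      Complex.exp_mul_I, ← Complex.ofReal_cos, ← Complex.ofReal_sin, Real.cos_neg, Real.sin_neg]
    push_cast
    ring
  simp only [h, Fin.sum_univ_five, Complex.real_smul]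
  simp only [levels, Matrix.cons_val, Real.cos_neg, Real.sin_neg, Real.cos_zero, Real.sin_zero]
  push_cast
  ring

theorem norm_sq_amplitude_exampleState (ħ : ℝ) (k : Fin 5) :
    ‖(exampleHamiltonian ħ).amplitude exampleState k‖ ^ 2 =
      ![7 / 15, 2 / 15, 2 / 15, 2 / 15, 2 / 15] k := by
  have h : (exampleHamiltonian ħ).amplitude exampleState k =
      (Real.sqrt 15 : ℂ)⁻¹ * ![(Real.sqrt 7 : ℂ), (Real.sqrt 2 : ℂ), (Real.sqrt 2 : ℂ),
        (Real.sqrt 2 : ℂ), (Real.sqrt 2 : ℂ)] k := by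
    simp [Hamiltonian.amplitude, exampleHamiltonian, exampleState, EuclideanSpace.inner_single_left]
  rw [h, norm_mul, mul_pow]
  fin_cases k <;> simp <;> norm_num

theorem inner_evolve_exampleState {ħ : ℝ} (hħ : 0 < ħ) (t : ℝ) :
    ⟪exampleState, (exampleHamiltonian ħ).evolve ħ exampleState t⟫_ℂ =
      ((overlapCos t / 15 : ℝ) : ℂ) := by
  have h := (exampleHamiltonian ħ).hasSum_overlap ħ exampleState t
  refine (h.unique (hasSum_fintype _)).trans ?_
  simp only [norm_sq_amplitude_exampleState]
  have he (k : Fin 5) : (exampleHamiltonian ħ).energy k * t / ħ = levels t k :=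
    levels_mul_div hħ t k
  simp only [he]
  rw [sum_levels_exp]
  simp only [Matrix.cons_val, overlapCos]
  push_cast
  ring

theorem fidelity_exampleState {ħ : ℝ} (hħ : 0 < ħ) (t : ℝ) :
    (exampleHamiltonian ħ).fidelity ħ exampleState t = (overlapCos t / 15) ^ 2 := by
  rw [Hamiltonian.fidelity, inner_evolve_exampleState hħ, Complex.norm_real, Real.norm_eq_abs, sq_abs]

theorem exampleRootFidelity_eq {ħ : ℝ} (hħ : 0 < ħ) (t : ℝ) :
    exampleRootFidelity ħ t = |overlapCos t / 15| := by
  rw [exampleRootFidelity, fidelity_exampleState hħ, Real.sqrt_sq_eq_abs]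

theorem setOf_exampleRootFidelity_eq_zero {ħ : ℝ} (hħ : 0 < ħ) :
    {t : ℝ | 0 ≤ t ∧ exampleRootFidelity ħ t = 0} = {t : ℝ | 0 ≤ t ∧ overlapCos t = 0} := by
  ext t
  simp [exampleRootFidelity_eq hħ]

theorem exists_isQSLData {ħ : ℝ} (hħ : 0 < ħ) :
    ∃ (τ₁ τ₂ : ℝ) (p : ℝ[X]), IsQSLData ħ τ₁ τ₂ p := by
  obtain ⟨τ₁, h₁⟩ := exists_isLeast_overlapCos_zero
  obtain ⟨τ₂, h₂, h₂'⟩ := exists_isLocalMin_overlapCos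
  obtain ⟨q, hq, hv⟩ := exists_squareNodes_interpolant τ₁ τ₂
  refine ⟨τ₁, τ₂, _, ?_, ?_, h₂', isHermiteInterpolant_expand hq hv⟩
  · rwa [setOf_exampleRootFidelity_eq_zero hħ]
  -- The root fidelity is the absolute value of the overlap, which is positive near `τ₂`, so the
  -- local minimum carries over.
  · have hb := abs_le.1 h₂'
    have hpos : ∀ᶠ t in nhds τ₂, 0 < overlapCos t :=
      continuous_overlapCos.continuousAt.eventually
        (lt_mem_nhds (overlapCos_pos (by linarith) (by linarith)))
    filter_upwards [h₂, hpos] with t ht ht0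
    rw [exampleRootFidelity_eq hħ, exampleRootFidelity_eq hħ]
    have h0 := overlapCos_pos (t := τ₂) (by linarith) (by linarith)
    rw [abs_of_pos (by positivity), abs_of_pos (by positivity)]
    gcongr

/-! ### Consequences of the moments -/

namespace Hamiltonian

variable {ι : Type*} {𝓗 : Type*} [NormedAddCommGroup 𝓗] [InnerProductSpace ℂ 𝓗]
  {H : Hamiltonian ι 𝓗} {ħ : ℝ} {ψ : 𝓗}

theorem HasGivenMoments.hasSum_pow (h : H.HasGivenMoments ħ ψ) (h1 : ‖ψ‖ = 1) {k : ℕ}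
    (hk : k < 18) : HasSum (fun j => ‖H.amplitude ψ j‖ ^ 2 * (H.energy j ^ 2) ^ k)
      (7 / 15 * (0 : ℝ) ^ k + 4 / 15 * (ħ ^ 2) ^ k + 4 / 15 * ((11 * ħ / 5) ^ 2) ^ k) := by
  rcases Nat.eq_zero_or_pos k with rfl | hk0
  · have := H.hasSum_norm_sq ψ
    rw [h1] at this
    convert this using 1
    · simp
    · norm_num
  · have := h k (Finset.mem_Icc.2 ⟨hk0, by omega⟩)
    simp only [pow_mul, sq_abs] at this
    convert this using 1
    rw [zero_pow hk0.ne', show (11 * ħ / 5) ^ 2 = (11 / 5) ^ 2 * ħ ^ 2 by ring, mul_pow]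
    ring

theorem HasGivenMoments.hasSum_eval (h : H.HasGivenMoments ħ ψ) (h1 : ‖ψ‖ = 1) {P : ℝ[X]}
    (hP : P.natDegree < 18) :
    HasSum (fun j => ‖H.amplitude ψ j‖ ^ 2 * P.eval (H.energy j ^ 2))
      (7 / 15 * P.eval 0 + 4 / 15 * P.eval (ħ ^ 2) + 4 / 15 * P.eval ((11 * ħ / 5) ^ 2)) := by
  simp only [eval_eq_sum_range' hP, Finset.mul_sum, ← Finset.sum_add_distrib]
  refine hasSum_sum fun k hk => ?_
  have hs := (h.hasSum_pow h1 (Finset.mem_range.1 hk)).mul_left (P.coeff k)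
  rw [mul_add, mul_add, mul_left_comm, mul_left_comm (P.coeff k) (4 / 15 : ℝ),
    mul_left_comm (P.coeff k) (4 / 15 : ℝ)] at hs
  exact hs.congr_fun fun j => mul_left_comm _ _ _

theorem HasGivenMoments.qslBound_eq (h : H.HasGivenMoments ħ ψ) (h1 : ‖ψ‖ = 1) (hħ : 0 < ħ)
    {q : ℝ[X]} (hq : q.natDegree < 18) (τ : ℝ) :
    H.qslBound ħ (expand ℝ 2 q) ψ τ = 7 / 15 * (expand ℝ 2 q).eval 0 +
      4 / 15 * (expand ℝ 2 q).eval τ + 4 / 15 * (expand ℝ 2 q).eval (11 * τ / 5) := by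
  simp only [expand_eval, eval_eq_sum_range' hq, Finset.mul_sum, ← Finset.sum_add_distrib, qslBound]
  refine Finset.sum_congr rfl fun k hk => ?_
  have hm : H.absMoment ψ (2 * k) =
      7 / 15 * (0 : ℝ) ^ k + 4 / 15 * (ħ ^ 2) ^ k + 4 / 15 * ((11 * ħ / 5) ^ 2) ^ k := by
    rw [absMoment]
    simp only [pow_mul, sq_abs]
    exact (h.hasSum_pow h1 (Finset.mem_range.1 hk)).tsum_eq
  rw [hm, mul_comm 2 k, coeff_expand_mul (by norm_num), mul_comm k 2, pow_mul,
    show τ ^ 2 = ħ ^ 2 * (τ / ħ) ^ 2 by field_simp,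
    show (11 * τ / 5) ^ 2 = (11 * ħ / 5) ^ 2 * (τ / ħ) ^ 2 by field_simp,
    mul_pow (ħ ^ 2), mul_pow ((11 * ħ / 5) ^ 2)]
  rcases Nat.eq_zero_or_pos k with rfl | hk0
  · norm_num; ring
  · rw [zero_pow hk0.ne', zero_pow two_ne_zero, zero_pow hk0.ne']; ring

/-- The given moments fix the energies that occur. -/
theorem HasGivenMoments.supportedOn (h : H.HasGivenMoments ħ ψ) (h1 : ‖ψ‖ = 1) (hħ : 0 < ħ) :
    H.SupportedOn ψ (levels ħ) := by
  refine ⟨levels_injective hħ, fun j hj => ?_⟩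
  -- Nonnegative on `[0, ∞)` and zero exactly at the three squared energies. Its mean in the state
  -- is determined by the moments and equals zero, so no other energy has weight.
  set P : ℝ[X] := X * (X - C (ħ ^ 2)) ^ 2 * (X - C ((11 * ħ / 5) ^ 2)) ^ 2 with hP
  have hdeg : P.natDegree < 18 := by
    have : P.natDegree ≤ 5 := by rw [hP]; compute_degree
    omega
  have hsum := h.hasSum_eval h1 hdeg
  have hz : 7 / 15 * P.eval 0 + 4 / 15 * P.eval (ħ ^ 2) + 4 / 15 * P.eval ((11 * ħ / 5) ^ 2) = 0 := by
    simp [hP]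
  rw [hz, hasSum_zero_iff_of_nonneg] at hsum
  · have hj0 := congrFun hsum j
    simp only [Pi.zero_apply, mul_eq_zero, ne_eq, OfNat.ofNat_ne_zero, not_false_eq_true,
      pow_eq_zero_iff, norm_eq_zero, hj, false_or, hP, eval_mul, eval_X, eval_pow, eval_sub, eval_C,
      sub_eq_zero, sq_eq_sq_iff_eq_or_eq_neg] at hj0
    rcases hj0 with (h0 | h0 | h0) | h0 | h0
    · exact ⟨0, by simpa [levels] using h0⟩
    · exact ⟨1, by simpa [levels] using h0⟩
    · exact ⟨2, by simpa [levels] using h0⟩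
    · exact ⟨3, by simpa [levels] using h0⟩
    · exact ⟨4, by simpa [levels] using h0⟩
  · intro j
    simp only [hP, eval_mul, eval_X, eval_pow, eval_sub, eval_C]
    positivity

theorem HasGivenMoments.norm_sq_energyPart (h : H.HasGivenMoments ħ ψ) (h1 : ‖ψ‖ = 1)
    (hħ : 0 < ħ) :
    ‖H.energyPart ψ (levels ħ 0)‖ ^ 2 = 7 / 15 ∧
    ‖H.energyPart ψ (levels ħ 1)‖ ^ 2 + ‖H.energyPart ψ (levels ħ 2)‖ ^ 2 = 4 / 15 ∧
    ‖H.energyPart ψ (levels ħ 3)‖ ^ 2 + ‖H.energyPart ψ (levels ħ 4)‖ ^ 2 = 4 / 15 := by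
  set w : Fin 5 → ℝ := fun k => ‖H.energyPart ψ (levels ħ k)‖ ^ 2 with hw
  have key {P : ℝ[X]} (hP : P.natDegree < 18) :
      w 0 * P.eval 0 + (w 1 + w 2) * P.eval (ħ ^ 2) + (w 3 + w 4) * P.eval ((11 * ħ / 5) ^ 2) =
      7 / 15 * P.eval 0 + 4 / 15 * P.eval (ħ ^ 2) + 4 / 15 * P.eval ((11 * ħ / 5) ^ 2) := by
    refine Eq.trans ?_ (((h.supportedOn h1 hħ).hasSum fun x => P.eval (x ^ 2)).unique
      (h.hasSum_eval h1 hP))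
    simp only [levels_sq, Fin.sum_univ_five, Matrix.cons_val, smul_eq_mul]
    ring
  change w 0 = _ ∧ w 1 + w 2 = _ ∧ w 3 + w 4 = _
  have hB : 0 < (11 * ħ / 5) ^ 2 - ħ ^ 2 := by nlinarith
  -- The test polynomials `X (X - ħ²)`, `X` and `1` give a triangular system for the three weights.
  have h34 := key (P := X * (X - C (ħ ^ 2))) (by
    have : (X * (X - C (ħ ^ 2)) : ℝ[X]).natDegree ≤ 2 := by compute_degree
    omega)
  have h12 := key (P := X) (by simp)
  have h0 := key (P := 1) (by simp)
  simp only [eval_mul, eval_X, eval_sub, eval_C, eval_one, zero_mul, sub_self, mul_zero, zero_add,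
    add_zero] at h34 h12 h0
  have e34 := mul_right_cancel₀ (by positivity) h34
  rw [e34] at h12 h0
  have e12 := mul_right_cancel₀ (by positivity) (add_right_cancel h12)
  exact ⟨by linarith, e12, e34⟩

end Hamiltonian

/-! ### Magic states -/

theorem exampleState_isMagicState {ħ τ₁ τ₂ : ℝ} {p : ℝ[X]} (hħ : 0 < ħ)
    (h : IsQSLData ħ τ₁ τ₂ p) :
    (exampleHamiltonian ħ).IsMagicState ħ p exampleState τ₁ := by
  have hleast := h.first
  rw [setOf_exampleRootFidelity_eq_zero hħ] at hleast
  obtain ⟨hb, hb'⟩ := isLeast_overlapCos_bounds hleast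
  obtain ⟨⟨q, hq, rfl⟩, -, heq⟩ := isHermiteInterpolant_le_cos hb hb' h.second_approx h.interpolant
  have hnorm : ‖exampleState‖ = 1 := by
    have := ((exampleHamiltonian ħ).hasSum_norm_sq exampleState).unique (hasSum_fintype _)
    simp only [norm_sq_amplitude_exampleState, Fin.sum_univ_five, Matrix.cons_val] at this
    rw [← sq_eq_sq₀ (norm_nonneg _) zero_le_one, this]
    norm_num
  have hmom : (exampleHamiltonian ħ).HasGivenMoments ħ exampleState := by
    intro k hk
    have hk0 : k ≠ 0 := by have := (Finset.mem_Icc.1 hk).1; omega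
    have he : (exampleHamiltonian ħ).energy = levels ħ := rfl
    have hs := hasSum_fintype fun j : Fin 5 =>
      ‖(exampleHamiltonian ħ).amplitude exampleState j‖ ^ 2 *
        |(exampleHamiltonian ħ).energy j| ^ (2 * k)
    convert hs using 1
    simp only [norm_sq_amplitude_exampleState, Fin.sum_univ_five, he, pow_mul, sq_abs, levels_sq,
      Matrix.cons_val]
    rw [zero_pow hk0, show (11 * ħ / 5) ^ 2 = (11 / 5) ^ 2 * ħ ^ 2 by ring, mul_pow]
    ring
  refine ⟨hnorm, hleast.1.1, hmom, ?_, ?_⟩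
  · rw [fidelity_exampleState hħ, hleast.1.2]
    norm_num
  · rw [hmom.qslBound_eq hnorm hħ hq, (heq 0).2 (mem_squareNodes.2 (by norm_num)),
      (heq τ₁).2 (mem_squareNodes.2 (by simp)),
      (heq (11 * τ₁ / 5)).2 (mem_squareNodes.2 (by simp)), Real.sqrt_zero, Real.cos_zero]
    have := hleast.1.2
    unfold overlapCos at this
    linarith

/-- At time 1 the phases are the levels in units of `ħ`, which differ by at most `22/5 < 2π`. -/
theorem phases_injective {ħ : ℝ} (hħ : 0 < ħ) : Function.Injective fun k =>
    Complex.exp (-Complex.I * ((levels ħ k * 1 / ħ : ℝ) : ℂ)) := by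
  intro j k h
  simp only [levels_mul_div hħ] at h
  refine levels_injective one_pos ?_
  obtain ⟨n, hn⟩ := Complex.exp_eq_exp_iff_exists_int.1 h
  have hn' : levels 1 j = levels 1 k - n * (2 * Real.pi) := by
    have h2 := congrArg Complex.im hn
    simp at h2
    linarith
  have hb (i : Fin 5) : |levels 1 i| ≤ 11 / 5 := by
    fin_cases i <;> simp [levels] <;> norm_num [abs_of_nonneg]
  have hj := abs_le.1 (hb j)
  have hk := abs_le.1 (hb k)
  have hpi := Real.pi_gt_three
  have hn1 : -1 < n := by
    by_contra! hle
    have : (n : ℝ) ≤ -1 := by exact_mod_cast hle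
    nlinarith
  have hn2 : n < 1 := by
    by_contra! hle
    have : (1 : ℝ) ≤ n := by exact_mod_cast hle
    nlinarith
  obtain rfl : n = 0 := by omega
  simpa using hn'

/-- The only nodes beyond `9.6` are `τ₁` and `11τ₁/5`; the latter is excluded because `11τ/5` would
exceed every node. -/
theorem eq_of_sq_mem_squareNodes {τ₁ τ₂ τ : ℝ} (h₁ : 9.6 < τ₁) (h₁' : τ₁ ≤ 9.74)
    (h₂ : |τ₂ - 4.110| ≤ 0.0005) (hτ : 9.6 < τ) (h : τ ^ 2 ∈ squareNodes τ₁ τ₂)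
    (h' : (11 * τ / 5) ^ 2 ∈ squareNodes τ₁ τ₂) : τ = τ₁ := by
  have hb := abs_le.1 h₂
  have hnode {x : ℝ} (hx : 0 ≤ x) (h : x ^ 2 ∈ squareNodes τ₁ τ₂) :
      x = 0 ∨ x = τ₁ ∨ x = τ₂ ∨ x = 11 * τ₁ / 5 ∨ x = 11 * τ₂ / 5 := by
    rw [mem_squareNodes, sq_eq_zero_iff, sq_eq_sq₀ hx (by linarith), sq_eq_sq₀ hx (by linarith),
      sq_eq_sq₀ hx (by linarith), sq_eq_sq₀ hx (by linarith)] at h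
    exact h
  rcases hnode (by linarith) h with h | h | h | h | h
  · linarith
  · exact h
  · linarith
  · rcases hnode (by linarith) h' with h' | h' | h' | h' | h' <;> linarith
  · linarith

theorem fin_five_eq_of_at_most_one {Q : Fin 5 → Prop} (h0 : ¬Q 0) (h3 : ¬Q 3) (h4 : ¬Q 4)
    (h12 : Q 1 → ¬Q 2) (j k : Fin 5) (hj : Q j) (hk : Q k) : j = k := by
  fin_cases j <;> fin_cases k <;> simp_all

end QSL

open QSL Hamiltonian in
theorem mainTheorem7 (ħ : ℝ) (hħ : 0 < ħ) :
    (∃ (τ₁ τ₂ : ℝ) (p : Polynomial ℝ), QSL.IsQSLData ħ τ₁ τ₂ p) ∧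
    ∀ (τ₁ τ₂ : ℝ) (p : Polynomial ℝ), QSL.IsQSLData ħ τ₁ τ₂ p →
      (QSL.exampleHamiltonian ħ).IsMagicState ħ p QSL.exampleState τ₁ ∧
      ∀ (ι : Type*) (𝓗 : Type*) [NormedAddCommGroup 𝓗] [InnerProductSpace ℂ 𝓗]
        (H : QSL.Hamiltonian ι 𝓗) (ψ : 𝓗) (τ : ℝ), H.IsMagicState ħ p ψ τ →
        (∃ (E : ℝ) (α : Fin 5 → ℂ) (ket : Fin 5 → 𝓗), 0 < E ∧ E = ħ ∧
          (∀ k, α k ≠ 0 → H.IsEigenket (QSL.levels E k) (ket k)) ∧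
          ψ = ∑ k, α k • ket k ∧
          τ = τ₁ * ħ / E ∧
          ‖α 0‖ ^ 2 = 7 / 15 ∧
          ‖α 1‖ ^ 2 + ‖α 2‖ ^ 2 = 4 / 15 ∧
          ‖α 3‖ ^ 2 + ‖α 4‖ ^ 2 = 4 / 15 ∧
          (∀ j k, α j = 0 → α k = 0 → j = k) ∧
          α 3 ≠ 0 ∧ α 4 ≠ 0 ∧
          (QSL.levels E 3 - QSL.levels E 4) * τ / ħ = 22 * τ₁ / 5 ∧
          2 * Real.pi < (QSL.levels E 3 - QSL.levels E 4) * τ / ħ) ∧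
        4 ≤ H.orbitDim ħ ψ := by
  refine ⟨exists_isQSLData hħ, fun τ₁ τ₂ p hdata => ⟨exampleState_isMagicState hħ hdata, ?_⟩⟩
  intro ι 𝓗 _ _ H ψ τ hmagic
  have hleast := hdata.first
  rw [setOf_exampleRootFidelity_eq_zero hħ] at hleast
  obtain ⟨hb, hb'⟩ := isLeast_overlapCos_bounds hleast
  obtain ⟨⟨q, hq, rfl⟩, hle, heq⟩ :=
    isHermiteInterpolant_le_cos hb hb' hdata.second_approx hdata.interpolant
  have hsupp := hmagic.moments.supportedOn hmagic.norm_eq_one hħ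
  obtain ⟨w0, w12, w34⟩ := hmagic.moments.norm_sq_energyPart hmagic.norm_eq_one hħ
  set P : Fin 5 → 𝓗 := fun k => H.energyPart ψ (levels ħ k) with hP
  change ‖P 0‖ ^ 2 = _ at w0
  change ‖P 1‖ ^ 2 + ‖P 2‖ ^ 2 = _ at w12
  change ‖P 3‖ ^ 2 + ‖P 4‖ ^ 2 = _ at w34
  -- the overlap vanishes
  have hov : ∑ k, ‖P k‖ ^ 2 • Complex.exp (-Complex.I * ((levels τ k : ℝ) : ℂ)) = 0 := by
    have h0 : ⟪ψ, H.evolve ħ ψ τ⟫_ℂ = 0 := by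
      have := hmagic.saturates.1
      rw [fidelity] at this
      exact norm_eq_zero.1 (pow_eq_zero_iff two_ne_zero |>.1 this)
    rw [← h0]
    refine Eq.trans ?_ ((hsupp.hasSum fun x =>
      Complex.exp (-Complex.I * ((x * τ / ħ : ℝ) : ℂ))).unique (H.hasSum_overlap ħ ψ τ))
    simp only [levels_mul_div hħ, hP]
  rw [sum_levels_exp (fun k => ‖P k‖ ^ 2)] at hov
  have hre := congrArg Complex.re hov
  have him := congrArg Complex.im hov
  simp only [Complex.sub_re, Complex.sub_im, Complex.ofReal_re, Complex.ofReal_im, Complex.mul_re,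
    Complex.mul_im, Complex.I_re, Complex.I_im, Complex.zero_re, Complex.zero_im] at hre him
  rw [w0, w12, w34] at hre
  have hov0 : overlapCos τ = 0 := by unfold overlapCos; linarith
  have hτ : 9.6 < τ := by
    by_contra! hlt
    exact (overlapCos_pos hmagic.time_nonneg hlt).ne' hov0
  -- the interpolant touches the cosine
  have hqsl := hmagic.saturates.2
  rw [hmagic.moments.qslBound_eq hmagic.norm_eq_one hħ hq, Real.sqrt_zero] at hqsl
  have c0 := hle 0
  have c1 := hle τ
  have c2 := hle (11 * τ / 5)
  rw [Real.cos_zero] at c0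
  -- The weighted sums of `p` and of `cos` are both zero, the weights are positive and `p ≤ cos`, so
  -- equality holds at each point.
  have hττ : τ = τ₁ := eq_of_sq_mem_squareNodes hb hb' hdata.second_approx hτ
    ((heq τ).1 (by linarith)) ((heq (11 * τ / 5)).1 (by linarith))
  subst hττ
  have hsin := abs_sin_lt_of_overlapCos_eq_zero hb hb' hov0
  have him' : (‖P 1‖ ^ 2 - ‖P 2‖ ^ 2) * Real.sin τ +
      (‖P 3‖ ^ 2 - ‖P 4‖ ^ 2) * Real.sin (11 * τ / 5) = 0 := by linarith
  -- The imaginary parts must cancel. As `|sin τ| < |sin (11τ/5)|`, the imbalance of the outer pair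
  -- is strictly below its total weight `4/15`, so neither outer level is empty.
  have h34 : |‖P 3‖ ^ 2 - ‖P 4‖ ^ 2| < 4 / 15 := by
    have h1 : |‖P 1‖ ^ 2 - ‖P 2‖ ^ 2| ≤ 4 / 15 := by
      rw [abs_le]; constructor <;> nlinarith [sq_nonneg ‖P 1‖, sq_nonneg ‖P 2‖]
    have h2 : |‖P 3‖ ^ 2 - ‖P 4‖ ^ 2| * |Real.sin (11 * τ / 5)| =
        |‖P 1‖ ^ 2 - ‖P 2‖ ^ 2| * |Real.sin τ| := by
      rw [← abs_mul, ← abs_mul, eq_neg_of_add_eq_zero_right him', abs_neg]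
    have h3 := abs_nonneg (Real.sin τ)
    by_contra! hge
    have h4 := mul_le_mul_of_nonneg_right h1 h3
    have h5 := mul_le_mul_of_nonneg_right hge (h3.trans hsin.le)
    linarith
  have hP3 : P 3 ≠ 0 := fun h => by
    rw [h, norm_zero] at h34 w34
    have := (abs_lt.1 h34).1
    linarith
  have hP4 : P 4 ≠ 0 := fun h => by
    rw [h, norm_zero] at h34 w34
    have := (abs_lt.1 h34).2
    linarith
  have hP0 : P 0 ≠ 0 := fun h => by
    rw [h, norm_zero] at w0
    norm_num at w0
  have hP12 : P 1 = 0 → P 2 ≠ 0 := fun h h' => by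
    rw [h, h', norm_zero] at w12
    norm_num at w12
  have hone := fin_five_eq_of_at_most_one (Q := fun k => P k = 0) hP0 hP3 hP4 hP12
  have hphase : (levels ħ 3 - levels ħ 4) * τ / ħ = 22 * τ / 5 := by
    simp only [levels, Matrix.cons_val]
    field_simp
    ring
  refine ⟨⟨ħ, fun k => (‖P k‖ : ℂ), fun k => ((‖P k‖ : ℂ)⁻¹) • P k, hħ, rfl, fun k hk => ?_, ?_, ?_,
    ?_, ?_, ?_, fun j k hj hk => hone j k (by simpa using hj) (by simpa using hk), by simpa using hP3,
    by simpa using hP4, hphase, ?_⟩, ?_⟩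
  · exact H.isEigenket_smul_energyPart (by simpa using hk)
  · refine hsupp.eq_sum.trans (Finset.sum_congr rfl fun k _ => ?_)
    change P k = (‖P k‖ : ℂ) • (‖P k‖ : ℂ)⁻¹ • P k
    by_cases hk : P k = 0
    · rw [hk, smul_zero, smul_zero]
    · rw [smul_smul, mul_inv_cancel₀ (by simpa using hk), one_smul]
  · field_simp
  · simpa using w0
  · simpa using w12
  · simpa using w34
  · rw [hphase]
    linarith [Real.pi_lt_four]
  · classical
    refine le_trans ?_ (hsupp.card_le_orbitDim (phases_injective hħ))
    have hcard : (Finset.univ.filter fun k => P k = 0).card ≤ 1 :=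
      Finset.card_le_one.2 fun j hj k hk =>
        hone j k (Finset.mem_filter.1 hj).2 (Finset.mem_filter.1 hk).2
    have h5 := Fintype.card_subtype_compl fun k => P k = 0
    have h6 := Fintype.card_subtype fun k => P k = 0
    rw [Fintype.card_fin] at h5
    change 4 ≤ Fintype.card {k // ¬P k = 0}
    omega
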